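/- Throughout, $\mathbf K$ is a small category, $\mathcal C$ is a complete category, and $\mathcal S_f$ is the category of finite simplicial sets. For $F:\mathbf K^{op}\times\mathbf K\to\mathcal C$ let $\prod^*F$ be the cosimplicial object $p\mapsto\prod_{K_0\to\cdots\to K_p}F(K_0,K_p)$ (product over all chains of $p$ composable maps), and, given mapping objects $\mathrm{Map}(K,X)$ functorial in $K\in\mathcal S_f^{op}$ and $X$, let the homotopy end be the end $\mathrm{ho}\!\int F=\int_{\Delta}\mathrm{Map}(\Delta[p],\prod^pF)$. A natural transformation $\eta:F\Rightarrow G$ induces a map $\mathrm{ho}\!\int F\to\mathrm{ho}\!\int G$. (A) Let $\mathcal C$ be a complete simplicial closed model category (a closed model category enriched over simplicial sets, with tensors $X\otimes K$ and cotensors $\mathrm{Map}(K,X)=X^K$ for finite $K$, satisfying Quillen's axiom (SM7)). If $\eta:F\Rightarrow G$ is such that $F(K,K')\to G(K,K')$ is a fibration for all $K,K'$ in $\mathbf K$, then $\mathrm{ho}\!\int F\to\mathrm{ho}\!\int G$ is a fibration. If in addition each $F(K,K')\to G(K,K')$ is a weak equivalence, so is $\mathrm{ho}\!\int F\to\mathrm{ho}\!\int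 G$. In particular, if each $F(K,K')$ is fibrant, then $\mathrm{ho}\!\int F$ is fibrant. (B) The same holds in a complete right model category $\mathcal C$ that is right enriched over $\mathcal S_f$ and in which products and towers preserve fibrations and trivial fibrations, for functors $F,G:\mathbf K^{op}\times\mathbf K\to\mathcal C_{fib}$ with values in the full subcategory $\mathcal C_{fib}$ of fibrant objects (on which $\mathrm{Map}$ is defined): if $\eta:F\Rightarrow G$ is a pointwise fibration, then $\mathrm{ho}\!\int F\to\mathrm{ho}\!\int G$ is a fibration; if $\eta$ is also a pointwise weak equivalence, it is a weak equivalence; and $\mathrm{ho}\!\int F$ is always fibrant. Here a *right model category* is a category with a terminal object $*$ and two subcategories, of weak equivalences and of fibrations, both containing all isomorphisms, such that weak equivalences satisfy two-out-of-three and are closed under retracts; the pullback $B\times_AC\to B$ of a fibration $C\to A$ along any $B\to A$ exists and is a fibration, and if $B\to A$ or $C\to A$ is a weak equivalence, so is its pullback; and every map factors as a weak equivalence followed by a fibration. It is *right enriched* over $\mathcal S_f$ if there is a functor $\mathrm{Map}:\mathcal S_f^{op}\times\mathcal C_{fib}\to\mathcal C_{fib}$ such that, for finite simplicial sets $K,L$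 and fibrant objects: (RE1) $\mathrm{Map}(K,*)\cong *$, and $\mathrm{Map}(K,-)$ preserves fibrations and base change along fibrations; (RE2) $\mathrm{Map}(\emptyset,X)\cong *$, and $\mathrm{Map}(-,X)$ sends injections to fibrations and pushouts along injections to pullbacks; (RE3) for an injection $i:K\to L$ and a fibration $p:B\to C$, the map $\mathrm{Map}(L,B)\to\mathrm{Map}(K,B)\times_{\mathrm{Map}(K,C)}\mathrm{Map}(L,C)$ is a fibration, and a weak equivalence if $i$ or $p$ is; (RE4) there is a natural weak equivalence $\omega:X\to\mathrm{Map}(\Delta[0],X)$; (RE5) products of fibrant objects are fibrant and $\mathrm{Map}(K,\prod X_i)\to\prod\mathrm{Map}(K,X_i)$ is an isomorphism. *Products preserve fibrations and trivial fibrations* if $\prod B_i\to\prod C_i$ is a fibration (resp. trivial fibration) for every family of fibrations (resp. trivial fibrations) $B_i\to C_i$ with $C_i$ fibrant. *Towers preserve fibrations and trivial fibrations* if for every map of towers of fibrations $(\cdots\to C_1\to C_0\to *)\to(\cdots\to D_1\to D_0\to *)$ such that $C_0\to D_0$ and all $C_{n+1}\to C_n\times_{D_n}D_{n+1}$ are fibrations,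 $\lim C_n\to\lim D_n$ is a fibration, and is a weak equivalence if every $C_n\to D_n$ is. -/

import Mathlib

open CategoryTheory CategoryTheory.Limits HomotopicalAlgebra Opposite MonoidalCategory Simplicial

universe w v u

/-! ### Finite simplicial sets -/

/-- The property of being a finite simplicial set (finitely many nondegenerate simplices). -/
def finiteSSets : ObjectProperty SSet.{w} := fun K => K.Finite

/-- The category of finite simplicial sets. -/
abbrev FinSSet := (finiteSSets.{w}).FullSubcategory

/-- The cosimplicial finite simplicial set `p ↦ Δ[p]`. -/
noncomputable def stdSimplexFin : CosimplicialObject FinSSet.{w} :=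
  finiteSSets.lift SSet.stdSimplex (fun n => by
    induction n using SimplexCategory.rec with | _ n
    change SSet.Finite _
    infer_instance)

/-- A map of simplicial sets is a weak equivalence if its geometric realization
is a homotopy equivalence. -/
def SSetWeakEquivalence {K L : SSet.{w}} (f : K ⟶ L) : Prop :=
  ∃ e : ContinuousMap.HomotopyEquiv (SSet.toTop.obj K) (SSet.toTop.obj L),
    e.toFun = (SSet.toTop.map f).hom

/-! ### Cosimplicial replacement, total objects, homotopy ends -/

section HomotopyEnds

variable {K : Type v} [SmallCategory K] {C : Type u} [Category.{v} C]

/-- The functor `F : Kᵒᵖ × K ⥤ C` evaluated at the end points of a chain `K₀ ⟶ ⋯ ⟶ Kₚ`. -/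
abbrev endpoints (F : Kᵒᵖ × K ⥤ C) {n : ℕ} (c : ComposableArrows K n) : C :=
  F.obj (op (c.obj 0), c.obj (Fin.last n))

/-- The restriction of a chain `K₀ ⟶ ⋯ ⟶ K_q` along `α : p ⟶ q`. -/
def restrictChain {p q : SimplexCategory} (α : p ⟶ q) (c : ComposableArrows K q.len) :
    ComposableArrows K p.len :=
  α.toOrderHom.monotone.functor ⋙ c

/-- The map `F (K_{α 0}, K_{α p}) ⟶ F (K₀, K_q)` induced by `K₀ ⟶ K_{α 0}` and
`K_{α p} ⟶ K_q`. -/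
def endpointsMap (F : Kᵒᵖ × K ⥤ C) {p q : SimplexCategory} (α : p ⟶ q)
    (c : ComposableArrows K q.len) : endpoints F (restrictChain α c) ⟶ endpoints F c :=
  F.map (Prod.mkHom (c.map (homOfLE (Fin.zero_le (α.toOrderHom 0)))).op
    (c.map (homOfLE (Fin.le_last (α.toOrderHom (Fin.last p.len))))))

lemma endpointsMap_id (F : Kᵒᵖ × K ⥤ C) {p : SimplexCategory} (c : ComposableArrows K p.len) :
    endpointsMap F (𝟙 p) c = 𝟙 (endpoints F c) := by
  refine Eq.trans (congrArg F.map ?_) (F.map_id _)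
  exact Prod.ext (congrArg Quiver.Hom.op (c.map_id _)) (c.map_id _)

lemma endpointsMap_comp (F : Kᵒᵖ × K ⥤ C) {p q r : SimplexCategory} (α : p ⟶ q) (β : q ⟶ r)
    (c : ComposableArrows K r.len) :
    endpointsMap F (α ≫ β) c = endpointsMap F α (restrictChain β c) ≫ endpointsMap F β c := by
  refine Eq.trans (congrArg F.map ?_) (F.map_comp _ _)
  exact Prod.ext (congrArg Quiver.Hom.op (c.map_comp _ _)) (c.map_comp _ _)

variable [HasLimits C]

/-- The cosimplicial replacement `p ↦ ∏_{K₀ ⟶ ⋯ ⟶ Kₚ} F (K₀, Kₚ)`. For `α : p ⟶ q`, the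
component at a `q`-chain `c` is the projection to the `p`-chain `c ∘ α` followed by
`F (c (α 0), c (α p)) ⟶ F (c 0, c q)`. -/
noncomputable def cosimplicialReplacement (F : Kᵒᵖ × K ⥤ C) : CosimplicialObject C where
  obj p := ∏ᶜ fun c : ComposableArrows K p.len => endpoints F c
  map α := Pi.lift fun c => Pi.π _ (restrictChain α c) ≫ endpointsMap F α c
  map_id p := by
    refine Pi.hom_ext _ _ fun c => ?_
    rw [Pi.lift_π, endpointsMap_id, Category.id_comp]
    exact Category.comp_id _
  map_comp α β := by
    refine Pi.hom_ext _ _ fun c => ?_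
    rw [Category.assoc, Pi.lift_π, Pi.lift_π, endpointsMap_comp]
    rw [Pi.lift_π_assoc, Category.assoc]
    rfl

/-- The map of cosimplicial replacements induced by a natural transformation. -/
noncomputable def cosimplicialReplacementMap {F G : Kᵒᵖ × K ⥤ C} (η : F ⟶ G) :
    cosimplicialReplacement F ⟶ cosimplicialReplacement G where
  app p := Limits.Pi.map fun c : ComposableArrows K p.len =>
    η.app (op (c.obj 0), c.obj (Fin.last p.len))
  naturality p q α := by
    refine Pi.hom_ext _ _ fun c => ?_
    dsimp only [cosimplicialReplacement]
    rw [Category.assoc, Category.assoc, Limits.Pi.map_π, Pi.lift_π, Pi.lift_π_assoc,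
      Limits.Pi.map_π_assoc, Category.assoc]
    congr 1
    exact η.naturality _

variable {D : Type*} [Category* D]

/-- The bifunctor `(p, q) ↦ Map (Δ[p], X^q)`, for a mapping object functor `Map` that is defined
on a category `D` and takes values in `C`. -/
noncomputable def totBifunctor (M : FinSSet.{w}ᵒᵖ ⥤ D ⥤ C) (X : CosimplicialObject D) :
    SimplexCategoryᵒᵖ ⥤ SimplexCategory ⥤ C :=
  stdSimplexFin.op ⋙ M ⋙ (Functor.whiskeringLeft SimplexCategory D C).obj X

/-- The map of bifunctors induced by a map of cosimplicial objects. -/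
noncomputable def totBifunctorMap (M : FinSSet.{w}ᵒᵖ ⥤ D ⥤ C) {X Y : CosimplicialObject D}
    (f : X ⟶ Y) : totBifunctor M X ⟶ totBifunctor M Y :=
  Functor.whiskerLeft stdSimplexFin.op
    (Functor.whiskerLeft M ((Functor.whiskeringLeft SimplexCategory D C).map f))

/-- The total object `∫_Δ Map (Δ[p], X^p)`. -/
noncomputable def tot (M : FinSSet.{w}ᵒᵖ ⥤ D ⥤ C) (X : CosimplicialObject D) : C :=
  end_ (totBifunctor M X)

/-- Functoriality of the total object. -/
noncomputable def totMap (M : FinSSet.{w}ᵒᵖ ⥤ D ⥤ C) {X Y : CosimplicialObject D} (f : X ⟶ Y) :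
    tot M X ⟶ tot M Y :=
  end_.map (totBifunctorMap M f)

end HomotopyEnds

/-! ### Simplicial closed model categories -/

section Simplicial

variable {C : Type u} [Category.{v} C] [SimplicialCategory C]

/-- For `α : K ⟶ hom (P, Y)`, the map `hom (X, P) ⟶ Map (K, hom (X, Y))` given by composing
with `α`. -/
noncomputable def cotensorComparison {K : SSet.{v}} {P Y : C} (α : K ⟶ (P ⟶[SSet.{v}] Y)) (X : C) :
    (X ⟶[SSet.{v}] P) ⟶ (ihom K).obj (X ⟶[SSet.{v}] Y) :=
  MonoidalClosed.curry
    ((β_ K (X ⟶[SSet.{v}] P)).hom ≫ (X ⟶[SSet.{v}] P) ◁ α ≫ eComp SSet.{v} X P Y)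

/-- `P` is a cotensor `Y ^ K`, with universal map `α`. -/
def IsCotensor {K : SSet.{v}} {P Y : C} (α : K ⟶ (P ⟶[SSet.{v}] Y)) : Prop :=
  ∀ X : C, IsIso (cotensorComparison α X)

/-- For `β : K ⟶ hom (X, T)`, the map `hom (T, Y) ⟶ Map (K, hom (X, Y))` given by composing
with `β`. -/
noncomputable def tensorComparison {K : SSet.{v}} {X T : C} (β : K ⟶ (X ⟶[SSet.{v}] T)) (Y : C) :
    (T ⟶[SSet.{v}] Y) ⟶ (ihom K).obj (X ⟶[SSet.{v}] Y) :=
  MonoidalClosed.curry (β ▷ (T ⟶[SSet.{v}] Y) ≫ eComp SSet.{v} X T Y)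

/-- `T` is a tensor `X ⊗ K`, with universal map `β`. -/
def IsTensor {K : SSet.{v}} {X T : C} (β : K ⟶ (X ⟶[SSet.{v}] T)) : Prop :=
  ∀ Y : C, IsIso (tensorComparison β Y)

/-- The map `hom (B, X) ⟶ hom (A, X) ×_{hom (A, Y)} hom (B, Y)` induced by `i : A ⟶ B` and
`p : X ⟶ Y`. -/
noncomputable def pullbackHom {A B X Y : C} (i : A ⟶ B) (p : X ⟶ Y) :
    (B ⟶[SSet.{v}] X) ⟶
      pullback (eHomWhiskerLeft SSet.{v} A p) (eHomWhiskerRight SSet.{v} i Y) :=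
  pullback.lift (eHomWhiskerRight SSet.{v} i X) (eHomWhiskerLeft SSet.{v} B p)
    (eHom_whisker_exchange SSet.{v} i p).symm

variable (C) in
/-- Quillen's axioms (SM0) and (SM7) for a closed model category that is a simplicial category.
As in Quillen, a fibration of simplicial sets is a map with the right lifting property against
the horn inclusions, and a trivial fibration is one with the right lifting property against the
boundary inclusions `∂Δ[n] ⟶ Δ[n]`. -/
class SimplicialModelCategory [ModelCategory C] : Prop where
  sm0_tensor (X : C) (K : SSet.{v}) [K.Finite] :
    ∃ (T : C) (β : K ⟶ (X ⟶[SSet.{v}] T)), IsTensor β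
  sm0_cotensor (Y : C) (K : SSet.{v}) [K.Finite] :
    ∃ (P : C) (α : K ⟶ (P ⟶[SSet.{v}] Y)), IsCotensor α
  sm7 {A B X Y : C} (i : A ⟶ B) (p : X ⟶ Y) [Cofibration i] [Fibration p] :
    SSet.modelCategoryQuillen.J.rlp (pullbackHom i p)
  sm7_trivial {A B X Y : C} (i : A ⟶ B) (p : X ⟶ Y) [Cofibration i] [Fibration p]
    (h : WeakEquivalence i ∨ WeakEquivalence p) :
    SSet.modelCategoryQuillen.I.rlp (pullbackHom i p)

variable (C) in
/-- The functor that sends `(K, Y)` to the presheaf `X ↦ Hom (K, hom (X, Y))` on `C`. -/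
noncomputable def mappingPresheaf : FinSSet.{v}ᵒᵖ × C ⥤ (Cᵒᵖ ⥤ Type v) where
  obj KY := (eHomFunctor SSet.{v} C).flip.obj KY.2 ⋙ coyoneda.obj (op KY.1.unop.obj)
  map f := Functor.whiskerLeft _ (coyoneda.map f.1.unop.hom.op) ≫
    Functor.whiskerRight ((eHomFunctor SSet.{v} C).flip.map f.2) _

lemma cotensor_bijective {K : SSet.{v}} {P Y : C} {α : K ⟶ (P ⟶[SSet.{v}] Y)} (hα : IsCotensor α)
    (X : C) : Function.Bijective (fun f : X ⟶ P => α ≫ eHomWhiskerRight SSet.{v} f Y) := by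
  have := hα X
  let e : (X ⟶ P) ≃ (K ⟶ (X ⟶[SSet.{v}] Y)) :=
    (eHomEquiv SSet.{v}).trans <|
      ((Iso.refl _).homCongr (asIso (cotensorComparison α X))).trans <|
      ((ihom.adjunction K).homEquiv _ _).symm.trans ((ρ_ K).homCongr (Iso.refl _))
  convert e.bijective using 1
  funext f
  change _ = (ρ_ K).inv ≫ ((ihom.adjunction K).homEquiv _ _).symm
    (𝟙 _ ≫ eHomEquiv SSet.{v} f ≫ cotensorComparison α X) ≫ 𝟙 _
  rw [MonoidalClosed.homEquiv_symm_apply_eq, Category.id_comp, Category.comp_id,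
    MonoidalClosed.uncurry_natural_left, cotensorComparison, MonoidalClosed.uncurry_curry,
    eHomWhiskerRight, BraidedCategory.braiding_naturality_right_assoc,
    ← whisker_exchange_assoc, leftUnitor_inv_naturality_assoc]
  rw [braiding_tensorUnit_right]
  simp

lemma mappingPresheaf_mem_essImage [ModelCategory C] [SimplicialModelCategory C]
    (KY : FinSSet.{v}ᵒᵖ × C) : (yoneda (C := C)).essImage ((mappingPresheaf C).obj KY) := by
  have : KY.1.unop.obj.Finite := KY.1.unop.property
  obtain ⟨P, α, hα⟩ := SimplicialModelCategory.sm0_cotensor KY.2 KY.1.unop.obj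
  refine ⟨P, ⟨NatIso.ofComponents
    (fun X => (Equiv.ofBijective _ (cotensor_bijective hα X.unop)).toIso) ?_⟩⟩
  intro X X' f
  ext g
  exact congrArg (α ≫ ·) (eHomWhiskerRight_comp SSet.{v} f.unop g KY.2) |>.trans
    (Category.assoc _ _ _).symm

variable (C) in
/-- The mapping object functor `(K, Y) ↦ Map (K, Y)` of a simplicial closed model category,
characterized by `Hom (X, Map (K, Y)) ≅ Hom (K, hom (X, Y))`, naturally in `K`, `X`, `Y`. -/
noncomputable def mappingObject [ModelCategory C] [SimplicialModelCategory C] :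
    FinSSet.{v}ᵒᵖ ⥤ C ⥤ C :=
  Functor.curry.obj
    (Functor.essImage.liftFunctor (mappingPresheaf C) yoneda mappingPresheaf_mem_essImage)

end Simplicial

/-! ### Right model categories and right enrichments -/

section RightModel

variable (C : Type u) [Category.{v} C] [CategoryWithFibrations C] [CategoryWithWeakEquivalences C]

/-- Right model categories. -/
class RightModelCategory : Prop where
  hasTerminal : HasTerminal C
  fibrations_comp : (fibrations C).IsStableUnderComposition
  isomorphisms_le_fibrations : MorphismProperty.isomorphisms C ≤ fibrations C
  isomorphisms_le_weakEquivalences : MorphismProperty.isomorphisms C ≤ weakEquivalences C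
  /-- The weak equivalences are a saturated subcategory. -/
  saturated : (weakEquivalences C).HasTwoOutOfThreeProperty
  retracts : (weakEquivalences C).IsStableUnderRetracts
  rm1_exists {A B X : C} (p : X ⟶ A) (f : B ⟶ A) [Fibration p] : HasPullback p f
  rm1_fibration {A B X P : C} {p : X ⟶ A} {f : B ⟶ A} {g : P ⟶ X} {q : P ⟶ B}
    (sq : IsPullback g q p f) [Fibration p] : Fibration q
  rm1_weakEquivalence_fibration {A B X P : C} {p : X ⟶ A} {f : B ⟶ A} {g : P ⟶ X} {q : P ⟶ B}
    (sq : IsPullback g q p f) [Fibration p] [WeakEquivalence p] : WeakEquivalence q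
  rm1_weakEquivalence {A B X P : C} {p : X ⟶ A} {f : B ⟶ A} {g : P ⟶ X} {q : P ⟶ B}
    (sq : IsPullback g q p f) [Fibration p] [WeakEquivalence f] : WeakEquivalence g
  rm5 : MorphismProperty.HasFactorization (weakEquivalences C) (fibrations C)

/-- A right enrichment over finite simplicial sets of a complete right model category. The mapping
objects `Map (K, X)` are defined for `K` a finite simplicial set and `X` fibrant, and are
functorial for all maps of finite simplicial sets and all maps of fibrant objects. -/
structure RightEnrichment [HasLimits C] where
  /-- The mapping object functor. -/
  Map : FinSSet.{w}ᵒᵖ ⥤ FibrantObject C ⥤ FibrantObject C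
  re1_terminal (K : FinSSet.{w}) (T : FibrantObject C) (hT : Nonempty (IsTerminal T.obj)) :
    Nonempty (IsTerminal ((Map.obj (op K)).obj T).obj)
  re1_fibration (K : FinSSet.{w}) {X Y : FibrantObject C} (p : X ⟶ Y) [Fibration p.hom] :
    Fibration ((Map.obj (op K)).map p).hom
  re1_baseChange (K : FinSSet.{w}) {P X B A : FibrantObject C} {g : P ⟶ X} {q : P ⟶ B}
    {p : X ⟶ A} {f : B ⟶ A} (sq : IsPullback g.hom q.hom p.hom f.hom) [Fibration p.hom] :
    IsPullback ((Map.obj (op K)).map g).hom ((Map.obj (op K)).map q).hom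
      ((Map.obj (op K)).map p).hom ((Map.obj (op K)).map f).hom
  re2_initial (K : FinSSet.{w}) (hK : Nonempty (IsInitial K.obj)) (X : FibrantObject C) :
    Nonempty (IsTerminal ((Map.obj (op K)).obj X).obj)
  re2_fibration {K L : FinSSet.{w}} (i : K ⟶ L) [Mono i.hom] (X : FibrantObject C) :
    Fibration ((Map.map i.op).app X).hom
  re2_pushout {K L K' L' : FinSSet.{w}} {i : K ⟶ L} {f : K ⟶ K'} {f' : L ⟶ L'} {i' : K' ⟶ L'}
    (sq : IsPushout i.hom f.hom f'.hom i'.hom) [Mono i.hom] (X : FibrantObject C) :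
    IsPullback ((Map.map f'.op).app X).hom ((Map.map i'.op).app X).hom
      ((Map.map i.op).app X).hom ((Map.map f.op).app X).hom
  re3_fibration {K L : FinSSet.{w}} (i : K ⟶ L) [Mono i.hom] {X Y : FibrantObject C} (p : X ⟶ Y)
    [Fibration p.hom] :
    Fibration (pullback.lift (f := ((Map.obj (op K)).map p).hom) (g := ((Map.map i.op).app Y).hom)
      ((Map.map i.op).app X).hom ((Map.obj (op L)).map p).hom
      (congrArg (·.hom) ((Map.map i.op).naturality p)).symm)
  re3_weakEquivalence {K L : FinSSet.{w}} (i : K ⟶ L) [Mono i.hom] {X Y : FibrantObject C}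
    (p : X ⟶ Y) [Fibration p.hom] (h : SSetWeakEquivalence i.hom ∨ WeakEquivalence p.hom) :
    WeakEquivalence
      (pullback.lift (f := ((Map.obj (op K)).map p).hom) (g := ((Map.map i.op).app Y).hom)
        ((Map.map i.op).app X).hom ((Map.obj (op L)).map p).hom
        (congrArg (·.hom) ((Map.map i.op).naturality p)).symm)
  /-- The natural map `ω : X ⟶ Map (Δ[0], X)`. -/
  ω : 𝟭 (FibrantObject C) ⟶ Map.obj (op (stdSimplexFin.obj ⦋0⦌))
  re4_weakEquivalence (X : FibrantObject C) : WeakEquivalence (ω.app X).hom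
  re4_degeneracy (X : FibrantObject C) (a b : stdSimplexFin.{w}.obj ⦋1⦌ ⟶ stdSimplexFin.obj ⦋0⦌) :
    ω.app X ≫ (Map.map a.op).app X = ω.app X ≫ (Map.map b.op).app X
  re5_fibrant {I : Type v} (X : I → FibrantObject C) : IsFibrant (∏ᶜ fun i => (X i).obj)
  re5_iso {I : Type v} (X : I → FibrantObject C) (K : FinSSet.{w}) :
    IsIso (Pi.lift fun i =>
      ((Map.obj (op K)).map
        (ObjectProperty.homMk (Pi.π (fun i => (X i).obj) i) :
          (⟨∏ᶜ fun i => (X i).obj, re5_fibrant X⟩ : FibrantObject C) ⟶ X i)).hom)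

/-- Products preserve fibrations and trivial fibrations (between fibrant objects). -/
structure ProductsPreserveFibrations [HasLimits C] : Prop where
  fibration {I : Type v} {X Y : I → C} (f : ∀ i, X i ⟶ Y i) (hY : ∀ i, IsFibrant (Y i))
    (hf : ∀ i, Fibration (f i)) : Fibration (Limits.Pi.map f)
  weakEquivalence {I : Type v} {X Y : I → C} (f : ∀ i, X i ⟶ Y i) (hY : ∀ i, IsFibrant (Y i))
    (hf : ∀ i, Fibration (f i)) (hf' : ∀ i, WeakEquivalence (f i)) :
    WeakEquivalence (Limits.Pi.map f)

variable {C} in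
/-- A map `X ⟶ Y` of towers of fibrations of fibrant objects in which `X₀ ⟶ Y₀` and all
`Xₙ₊₁ ⟶ Xₙ ×_{Yₙ} Yₙ₊₁` are fibrations. -/
structure IsTowerFibration [HasLimits C] {X Y : ℕᵒᵖ ⥤ C} (f : X ⟶ Y) : Prop where
  isFibrant_source : IsFibrant (X.obj (op 0))
  isFibrant_target : IsFibrant (Y.obj (op 0))
  fibration_source (n : ℕ) : Fibration (X.map (homOfLE n.le_succ).op)
  fibration_target (n : ℕ) : Fibration (Y.map (homOfLE n.le_succ).op)
  fibration_zero : Fibration (f.app (op 0))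
  fibration_succ (n : ℕ) :
    Fibration (pullback.lift (f := f.app (op n)) (g := Y.map (homOfLE n.le_succ).op)
      (X.map (homOfLE n.le_succ).op) (f.app (op (n + 1))) (f.naturality _))

/-- Towers preserve fibrations and trivial fibrations. -/
structure TowersPreserveFibrations [HasLimits C] : Prop where
  fibration {X Y : ℕᵒᵖ ⥤ C} (f : X ⟶ Y) (hf : IsTowerFibration f) : Fibration (limMap f)
  weakEquivalence {X Y : ℕᵒᵖ ⥤ C} (f : X ⟶ Y) (hf : IsTowerFibration f)
    (hf' : ∀ n, WeakEquivalence (f.app (op n))) : WeakEquivalence (limMap f)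

end RightModel

/-! ### The homotopy ends -/

section

variable {K : Type v} [SmallCategory K] {C : Type u} [Category.{v} C] [HasLimits C]

/-- The homotopy end in a complete simplicial closed model category. -/
noncomputable def homotopyEnd [SimplicialCategory C] [ModelCategory C] [SimplicialModelCategory C]
    (F : Kᵒᵖ × K ⥤ C) : C :=
  tot (mappingObject C) (cosimplicialReplacement F)

/-- The map of homotopy ends induced by a natural transformation. -/
noncomputable def homotopyEndMap [SimplicialCategory C] [ModelCategory C]
    [SimplicialModelCategory C] {F G : Kᵒᵖ × K ⥤ C} (η : F ⟶ G) : homotopyEnd F ⟶ homotopyEnd G :=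
  totMap (mappingObject C) (cosimplicialReplacementMap η)

namespace RightEnrichment

variable [CategoryWithFibrations C] [CategoryWithWeakEquivalences C]
  (E : RightEnrichment.{w} C)

/-- The cosimplicial replacement of a pointwise fibrant functor, as a cosimplicial fibrant
object. -/
noncomputable def cosimplicialReplacement (F : Kᵒᵖ × K ⥤ FibrantObject C) :
    CosimplicialObject (FibrantObject C) :=
  (fibrantObjects C).lift (_root_.cosimplicialReplacement (F ⋙ FibrantObject.ι))
    (fun p => E.re5_fibrant
      (fun c : ComposableArrows K p.len => F.obj (op (c.obj 0), c.obj (Fin.last p.len))))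

/-- The map of cosimplicial replacements induced by a natural transformation. -/
noncomputable def cosimplicialReplacementMap {F G : Kᵒᵖ × K ⥤ FibrantObject C} (η : F ⟶ G) :
    E.cosimplicialReplacement F ⟶ E.cosimplicialReplacement G where
  app p := ObjectProperty.homMk
    ((_root_.cosimplicialReplacementMap (Functor.whiskerRight η FibrantObject.ι)).app p)
  naturality _ _ α := ObjectProperty.hom_ext _
    ((_root_.cosimplicialReplacementMap (Functor.whiskerRight η FibrantObject.ι)).naturality α)

/-- The homotopy end of a pointwise fibrant functor in a right enriched right model category. -/
noncomputable def homotopyEnd (F : Kᵒᵖ × K ⥤ FibrantObject C) : C :=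
  tot (E.Map ⋙ (Functor.whiskeringRight _ _ _).obj FibrantObject.ι) (E.cosimplicialReplacement F)

/-- The map of homotopy ends induced by a natural transformation. -/
noncomputable def homotopyEndMap {F G : Kᵒᵖ × K ⥤ FibrantObject C} (η : F ⟶ G) :
    E.homotopyEnd F ⟶ E.homotopyEnd G :=
  totMap (E.Map ⋙ (Functor.whiskeringRight _ _ _).obj FibrantObject.ι)
    (E.cosimplicialReplacementMap η)

end RightEnrichment

end

-- The homotopy end is filtered by the skeleta of the nerve of `K`. A point of it is a compatible
-- family that assigns to each chain `c` of dimension `p` a point of `Map (Δ[p], F (c₀, cₚ))`.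
-- Restricting such families to the chains that come from dimension less than `n` gives a tower
-- `chainLimit.tower`. It starts with a terminal object, because there are no chains at stage `0`.
-- Its limit is the homotopy end (`isLimitTotCone`), because each chain appears at a finite stage
-- and `Map (Δ[p], -)` preserves products.
--
-- The step from stage `n` to stage `n + 1` is an attachment of cells (`isPullback_topCells`): it is
-- a base change of the product, over the nondegenerate `n`-chains `d`, of the maps `Map (Δ[n], F
-- (d₀, dₙ)) ⟶ Map (∂Δ[n], F (d₀, dₙ))`. Two facts make this work. By Eilenberg–Zilber every chain
-- is a degeneracy of a unique nondegenerate one, and degeneracies keep the end points, so `F` sees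
-- no difference between a chain and its degeneracies (`isIso_endpointsMap`). Moreover `Map (∂Δ[n],
-- X)` is the limit of the `Map (Δ[p], X)` over the simplices of `∂Δ[n]`
-- (`isGluedFromSimplices_boundary`).
--
-- For `η : F ⟶ G` the relative step is therefore a base change of a product of corner maps `Map
-- (Δ[n], X) ⟶ Map (∂Δ[n], X) ×_{Map (∂Δ[n], Y)} Map (Δ[n], Y)` (`relativeMap_mem`). So a class of
-- maps contains the map of homotopy ends once it is stable under base change and suitable towers
-- and contains these products (`totMap_mem`). In a right model category the corner maps are handled
-- by (RE3), and their products and towers by hypothesis. In a simplicial model category the classes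
-- are given by right lifting properties, hence are stable under products and towers, and the corner
-- maps are handled by (SM7) and adjunction. Fibrancy is the case where `G` is constant at the
-- terminal object.

universe u'

/-! ### The skeletal filtration of the chains of a category -/

section Chains

variable (K : Type v) [SmallCategory K]

/-- Families of sets of chains, one for each dimension. -/
abbrev ChainSet := ∀ p : SimplexCategory, Set (ComposableArrows K p.len)

/-- The chains that are restricted from a chain of dimension less than `n`. -/
def skeletonChains (n : ℕ) : ChainSet K := fun p =>
  {c | ∃ m < n, ∃ (σ : p ⟶ ⦋m⦌) (d : ComposableArrows K m), restrictChain σ d = c}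

variable {K}

lemma skeletonChains_zero (p : SimplexCategory) (c : ComposableArrows K p.len) :
    c ∉ skeletonChains K 0 p := by
  rintro ⟨m, hm, _⟩
  exact absurd hm (Nat.not_lt_zero _)

lemma skeletonChains_mono : Monotone (skeletonChains K) := by
  rintro n n' h p _ ⟨m, hm, σ, d, rfl⟩
  exact ⟨m, hm.trans_le h, σ, d, rfl⟩

lemma mem_skeletonChains {p : SimplexCategory} (c : ComposableArrows K p.len) {n : ℕ}
    (h : p.len < n) : c ∈ skeletonChains K n p :=
  ⟨p.len, h, 𝟙 p, c, rfl⟩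

lemma restrictChain_mem_skeletonChains {n : ℕ} {p q : SimplexCategory} (α : p ⟶ q)
    {c : ComposableArrows K q.len} (hc : c ∈ skeletonChains K n q) :
    restrictChain α c ∈ skeletonChains K n p := by
  obtain ⟨m, hm, σ, d, rfl⟩ := hc
  exact ⟨m, hm, α ≫ σ, d, rfl⟩

/-- The epi-mono factorization of `σ` passes through a simplex of dimension strictly less than `n`.
-/
lemma restrictChain_mem_of_not_epi {n : ℕ} {p : SimplexCategory} (σ : p ⟶ ⦋n⦌) (hσ : ¬ Epi σ)
    (d : ComposableArrows K n) : restrictChain σ d ∈ skeletonChains K n p := by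
  have h₁ : (image σ).len ≤ n := SimplexCategory.len_le_of_mono (image.ι σ)
  have h₂ : (image σ).len ≠ n := fun h => by
    have : IsIso (image.ι σ) := (SimplexCategory.isIso_iff_of_mono _).2 h
    apply hσ
    rw [← image.fac σ]
    infer_instance
  refine ⟨_, lt_of_le_of_ne h₁ h₂, factorThruImage σ, restrictChain (image.ι σ) d, ?_⟩
  change restrictChain (factorThruImage σ ≫ image.ι σ) d = _
  rw [image.fac]

/-- An epimorphism `σ` has a section, and restricting along it would put `d` itself in the skeleton.
-/
lemma not_epi_of_restrictChain_mem {n : ℕ} {p : SimplexCategory} {σ : p ⟶ ⦋n⦌}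
    {d : ComposableArrows K n} (hd : d ∉ skeletonChains K n ⦋n⦌)
    (h : restrictChain σ d ∈ skeletonChains K n p) : ¬ Epi σ := by
  intro _
  obtain ⟨⟨s⟩⟩ := isSplitEpi_of_epi σ
  apply hd
  have := restrictChain_mem_skeletonChains s.section_ h
  change restrictChain (s.section_ ≫ σ) d ∈ _ at this
  rwa [s.id] at this

/-- Existence half of Eilenberg–Zilber, for the chains that are new at stage `n + 1`. -/
lemma exists_restrictChain_eq {n : ℕ} {p : SimplexCategory} {c : ComposableArrows K p.len}
    (hc : c ∈ skeletonChains K (n + 1) p) (hc' : c ∉ skeletonChains K n p) :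
    ∃ (σ : p ⟶ ⦋n⦌) (_ : Epi σ) (d : ComposableArrows K n), d ∉ skeletonChains K n ⦋n⦌ ∧
      restrictChain σ d = c := by
  obtain ⟨m, hm, σ, d, rfl⟩ := hc
  obtain rfl : m = n := by
    by_contra h
    exact hc' ⟨m, by lia, σ, d, rfl⟩
  refine ⟨σ, ?_, d, fun h => hc' (restrictChain_mem_skeletonChains σ h), rfl⟩
  by_contra h
  exact hc' (restrictChain_mem_of_not_epi σ h d)

lemma mem_nonDegenerate_nerve {n : ℕ} {d : ComposableArrows K n}
    (hd : d ∉ skeletonChains K n ⦋n⦌) : d ∈ (nerve K).nonDegenerate n := by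
  rintro ⟨m, hm, f, y, hy⟩
  exact hd ⟨m, hm, f, y, hy⟩

/-- Uniqueness half of Eilenberg–Zilber, imported from the nerve of `K`. -/
lemma restrictChain_injective {n : ℕ} {p : SimplexCategory} {σ σ' : p ⟶ ⦋n⦌} [Epi σ]
    {d d' : ComposableArrows K n} (hd : d ∉ skeletonChains K n ⦋n⦌)
    (hd' : d' ∉ skeletonChains K n ⦋n⦌) (h : restrictChain σ d = restrictChain σ' d') :
    σ = σ' ∧ d = d' := by
  induction p using SimplexCategory.rec with | _ p
  exact ⟨(nerve K).unique_nonDegenerate_map (n := p) (restrictChain σ d) σ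
      ⟨d, mem_nonDegenerate_nerve hd⟩ rfl σ' ⟨d', mem_nonDegenerate_nerve hd'⟩ h,
    congrArg Subtype.val <| (nerve K).unique_nonDegenerate_simplex (n := p) (restrictChain σ d) σ
      ⟨d, mem_nonDegenerate_nerve hd⟩ rfl σ' ⟨d', mem_nonDegenerate_nerve hd'⟩ h⟩

lemma isIso_map_homOfLE {n : ℕ} (c : ComposableArrows K n) {i j : Fin (n + 1)} (h : i ≤ j)
    (h' : i = j) : IsIso (c.map (homOfLE h)) := by
  subst h'
  rw [Subsingleton.elim (homOfLE h) (𝟙 i), c.map_id]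
  infer_instance

/-- A surjective monotone map preserves the first and last vertex, so both arrows to which `F` is
applied are isomorphisms. This is why a component at a degenerate chain carries no new information.
-/
instance isIso_endpointsMap {D : Type u} [Category.{v} D] (F : Kᵒᵖ × K ⥤ D) {p q : SimplexCategory}
    (σ : p ⟶ q) [Epi σ] (c : ComposableArrows K q.len) : IsIso (endpointsMap F σ c) := by
  have hσ : Function.Surjective σ.toOrderHom := SimplexCategory.epi_iff_surjective.1 inferInstance
  have h₀ : IsIso (c.map (homOfLE (Fin.zero_le (σ.toOrderHom 0)))) := by
    apply isIso_map_homOfLE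
    obtain ⟨i, hi⟩ := hσ 0
    exact le_antisymm (Fin.zero_le _) (hi ▸ σ.toOrderHom.monotone (Fin.zero_le i))
  have h₁ : IsIso (c.map (homOfLE (Fin.le_last (σ.toOrderHom (Fin.last p.len))))) := by
    apply isIso_map_homOfLE
    obtain ⟨i, hi⟩ := hσ (Fin.last _)
    exact le_antisymm (Fin.le_last _) (hi ▸ σ.toOrderHom.monotone (Fin.le_last i))
  have : IsIso (Prod.mkHom (c.map (homOfLE (Fin.zero_le (σ.toOrderHom 0)))).op
      (c.map (homOfLE (Fin.le_last (σ.toOrderHom (Fin.last p.len)))))) :=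
    (isIso_prod_iff _ _).2 ⟨inferInstance, h₁⟩
  exact @Functor.map_isIso _ _ _ _ _ _ F _ this

end Chains

/-! ### Limits of mapping objects over sets of chains -/

section ChainLimits

variable {K : Type v} [SmallCategory K] {C : Type u} [Category.{v} C]
  {D : Type u'} [Category.{v} D] (M : FinSSet.{w}ᵒᵖ ⥤ D ⥤ C) (F : Kᵒᵖ × K ⥤ D)

/-- The shape of the diagram whose limit consists of compatible families indexed by the chains
in `S`. -/
def chainShape (S : ChainSet K) : MulticospanShape.{v, v} where
  L := Σ p : SimplexCategory, S p
  R := Σ (pq : SimplexCategory × SimplexCategory) (α : pq.1 ⟶ pq.2),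
    { c : S pq.2 // restrictChain α c.1 ∈ S pq.1 }
  fst r := ⟨r.1.2, r.2.2.1⟩
  snd r := ⟨r.1.1, ⟨restrictChain r.2.1 r.2.2.1.1, r.2.2.2⟩⟩

/-- The diagram whose limit consists of the families of points of `Map (Δ[p], F (c₀, cₚ))`,
for `c` in `S`, such that the restriction of the point at `c` along `α` is the image of the
point at `c ∘ α`. -/
noncomputable def chainIndex (S : ChainSet K) : MulticospanIndex (chainShape S) C where
  left l := (M.obj (op (stdSimplexFin.obj l.1))).obj (endpoints F l.2.1)
  right r := (M.obj (op (stdSimplexFin.obj r.1.1))).obj (endpoints F r.2.2.1.1)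
  fst r := (M.map (stdSimplexFin.map r.2.1).op).app _
  snd r := (M.obj _).map (endpointsMap F r.2.1 r.2.2.1.1)

section

variable {F} {G : Kᵒᵖ × K ⥤ D} (η : F ⟶ G)

/-- The component of a natural transformation at the end points of a chain. -/
def endpointsHom {n : ℕ} (c : ComposableArrows K n) : endpoints F c ⟶ endpoints G c :=
  η.app (op (c.obj 0), c.obj (Fin.last n))

lemma endpointsMap_naturality {p q : SimplexCategory} (α : p ⟶ q)
    (c : ComposableArrows K q.len) :
    endpointsMap F α c ≫ endpointsHom η c =
      endpointsHom η (restrictChain α c) ≫ endpointsMap G α c :=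
  η.naturality _

end

variable [HasLimits C]

/-- The object of compatible families indexed by the chains in `S`. -/
noncomputable def chainLimit (S : ChainSet K) : C := multiequalizer (chainIndex M F S)

namespace chainLimit

variable {M F} {S : ChainSet K}

/-- The component of a family at a chain. -/
noncomputable def π {p : SimplexCategory} (c : ComposableArrows K p.len) (hc : c ∈ S p) :
    chainLimit M F S ⟶ (M.obj (op (stdSimplexFin.obj p))).obj (endpoints F c) :=
  Multiequalizer.ι (chainIndex M F S) ⟨p, c, hc⟩

lemma condition {p q : SimplexCategory} (α : p ⟶ q) (c : ComposableArrows K q.len)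
    (hc : c ∈ S q) (hc' : restrictChain α c ∈ S p) :
    π (M := M) (F := F) c hc ≫ (M.map (stdSimplexFin.map α).op).app _ =
      π (restrictChain α c) hc' ≫ (M.obj _).map (endpointsMap F α c) :=
  Multiequalizer.condition (chainIndex M F S) ⟨⟨p, q⟩, α, ⟨c, hc⟩, hc'⟩

lemma condition_assoc {p q : SimplexCategory} (α : p ⟶ q) (c : ComposableArrows K q.len)
    (hc : c ∈ S q) (hc' : restrictChain α c ∈ S p) {Z : C}
    (f : (M.obj (op (stdSimplexFin.obj p))).obj (endpoints F c) ⟶ Z) :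
    π (M := M) (F := F) c hc ≫ (M.map (stdSimplexFin.map α).op).app _ ≫ f =
      π (restrictChain α c) hc' ≫ (M.obj _).map (endpointsMap F α c) ≫ f := by
  rw [← Category.assoc, condition α c hc hc', Category.assoc]

lemma hom_ext {T : C} {f g : T ⟶ chainLimit M F S}
    (h : ∀ (p : SimplexCategory) (c : ComposableArrows K p.len) (hc : c ∈ S p),
      f ≫ π c hc = g ≫ π c hc) : f = g :=
  Multiequalizer.hom_ext _ _ _ fun ⟨p, c, hc⟩ => h p c hc

section Lift

variable {T : C}
  (x : ∀ (p : SimplexCategory) (c : ComposableArrows K p.len), c ∈ S p →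
    (T ⟶ (M.obj (op (stdSimplexFin.obj p))).obj (endpoints F c)))
  (hx : ∀ ⦃p q : SimplexCategory⦄ (α : p ⟶ q) (c : ComposableArrows K q.len) (hc : c ∈ S q)
    (hc' : restrictChain α c ∈ S p),
    x q c hc ≫ (M.map (stdSimplexFin.map α).op).app _ =
      x p (restrictChain α c) hc' ≫ (M.obj _).map (endpointsMap F α c))

/-- The map to the limit given by a compatible family of maps. -/
noncomputable def lift : T ⟶ chainLimit M F S :=
  Multiequalizer.lift (chainIndex M F S) T (fun l => x l.1 l.2.1 l.2.2)
    (fun r => hx r.2.1 r.2.2.1.1 r.2.2.1.2 r.2.2.2)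

@[simp]
lemma lift_π {p : SimplexCategory} (c : ComposableArrows K p.len) (hc : c ∈ S p) :
    lift x hx ≫ π c hc = x p c hc :=
  Multiequalizer.lift_ι (chainIndex M F S) _ _ _ ⟨p, c, hc⟩

end Lift

/-- The restriction of families to a smaller set of chains. -/
noncomputable def restrict {S S' : ChainSet K} (h : S ≤ S') :
    chainLimit M F S' ⟶ chainLimit M F S :=
  lift (fun p c hc => π c (h p hc)) (fun _ _ α c _ _ => condition α c _ _)

@[simp]
lemma restrict_π {S S' : ChainSet K} (h : S ≤ S') {p : SimplexCategory}
    (c : ComposableArrows K p.len) (hc : c ∈ S p) :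
    restrict (M := M) (F := F) h ≫ π c hc = π c (h p hc) :=
  lift_π _ _ _ _

@[simp]
lemma restrict_π_assoc {S S' : ChainSet K} (h : S ≤ S') {p : SimplexCategory}
    (c : ComposableArrows K p.len) (hc : c ∈ S p) {Z : C}
    (f : (M.obj (op (stdSimplexFin.obj p))).obj (endpoints F c) ⟶ Z) :
    restrict (M := M) (F := F) h ≫ π c hc ≫ f = π c (h p hc) ≫ f := by
  rw [← Category.assoc, restrict_π]

variable {G : Kᵒᵖ × K ⥤ D} (η : F ⟶ G)

variable (S) in
/-- Functoriality in the coefficients. -/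
noncomputable def map : chainLimit M F S ⟶ chainLimit M G S :=
  lift (fun p c hc => π c hc ≫ (M.obj _).map (endpointsHom η c))
    (fun p q α c hc hc' => by
      rw [Category.assoc, Category.assoc, (M.map (stdSimplexFin.map α).op).naturality,
        condition_assoc α c hc hc', ← Functor.map_comp, ← Functor.map_comp,
        endpointsMap_naturality])

@[simp]
lemma map_π {p : SimplexCategory} (c : ComposableArrows K p.len) (hc : c ∈ S p) :
    map (M := M) S η ≫ π c hc =
      π c hc ≫ (M.obj _).map (endpointsHom η c) :=
  lift_π _ _ _ _

lemma map_π_assoc {p : SimplexCategory} (c : ComposableArrows K p.len) (hc : c ∈ S p) {Z : C}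
    (f : (M.obj (op (stdSimplexFin.obj p))).obj (endpoints G c) ⟶ Z) :
    map (M := M) S η ≫ π c hc ≫ f = π c hc ≫ (M.obj _).map (endpointsHom η c) ≫ f := by
  rw [← Category.assoc, map_π, Category.assoc]

lemma restrict_map {S S' : ChainSet K} (h : S ≤ S') :
    restrict (M := M) h ≫ map S η = map S' η ≫ restrict h := by
  refine hom_ext fun p c hc => ?_
  simp

variable (M F) in
/-- The tower of the limits over the skeleta. -/
noncomputable def tower : ℕᵒᵖ ⥤ C where
  obj n := chainLimit M F (skeletonChains K n.unop)
  map f := restrict (skeletonChains_mono (leOfHom f.unop))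
  map_id _ := hom_ext fun p c hc => by simp
  map_comp _ _ := hom_ext fun p c hc => by simp

variable (M) in
/-- Functoriality of the tower in the coefficients. -/
noncomputable def towerMap : tower M F ⟶ tower M G where
  app n := map (skeletonChains K n.unop) η
  naturality _ _ _ := restrict_map η _

variable (M F) in
/-- The tower starts with a terminal object. -/
noncomputable def isTerminalTowerZero : IsTerminal ((tower M F).obj (op 0)) :=
  IsTerminal.ofUniqueHom
    (fun _ => lift (fun p c hc => (skeletonChains_zero p c hc).elim)
      (fun _ _ _ _ hc => (skeletonChains_zero _ _ hc).elim))
    (fun _ _ => hom_ext fun p c hc => (skeletonChains_zero p c hc).elim)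

end chainLimit

end ChainLimits

/-! ### Mapping objects out of the boundary of a simplex -/

section Boundary

/-- The map `Δ[p] ⟶ L` that corresponds to a `p`-simplex of `L`. -/
noncomputable def simplexMap {L : FinSSet.{w}} {p : SimplexCategory} (s : L.obj.obj (op p)) :
    stdSimplexFin.{w}.obj p ⟶ L :=
  ObjectProperty.homMk (SSet.yonedaEquiv.symm s)

/-- A subcomplex of `Δ[n]`, as a finite simplicial set. -/
noncomputable def subcomplexFin {n : ℕ} (A : (Δ[n] : SSet.{w}).Subcomplex) : FinSSet.{w} :=
  ⟨A, (inferInstance : SSet.Finite A)⟩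

/-- The inclusion of a subcomplex of `Δ[n]`. -/
noncomputable def subcomplexFinι {n : ℕ} (A : (Δ[n] : SSet.{w}).Subcomplex) :
    subcomplexFin A ⟶ stdSimplexFin.{w}.obj ⦋n⦌ :=
  ObjectProperty.homMk A.ι

instance mono_subcomplexFinι {n : ℕ} (A : (Δ[n] : SSet.{w}).Subcomplex) :
    Mono (subcomplexFinι A).hom :=
  inferInstanceAs (Mono A.ι)

lemma simplexMap_comp_subcomplexFinι {n : ℕ} (A : (Δ[n] : SSet.{w}).Subcomplex)
    {p : SimplexCategory} (s : (subcomplexFin A).obj.obj (op p)) :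
    simplexMap s ≫ subcomplexFinι A =
      stdSimplexFin.{w}.map (SSet.stdSimplex.objEquiv s.1) := by
  apply ObjectProperty.hom_ext
  exact (SSet.yonedaEquiv_symm_comp s A.ι).trans
    ((Equiv.symm_apply_eq _).2 (SSet.yonedaEquiv_map _).symm)

lemma simplexMap_map {L : FinSSet.{w}} {p q : SimplexCategory} (α : p ⟶ q)
    (s : L.obj.obj (op q)) :
    simplexMap (L.obj.map α.op s) = stdSimplexFin.map α ≫ simplexMap s := by
  apply ObjectProperty.hom_ext
  exact (SSet.yonedaEquiv_symm_naturality_left _ _).symm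

variable {C : Type u} [Category.{v} C] {D : Type u'} [Category.{v} D]
  (M : FinSSet.{w}ᵒᵖ ⥤ D ⥤ C)

/-- The mapping objects `Map (L, X)` are the limits of the `Map (Δ[p], X)`, over the simplices
of `L`. -/
def IsGluedFromSimplices (L : FinSSet.{w}) : Prop :=
  ∀ ⦃X : D⦄ ⦃T : C⦄ (y : ∀ p : SimplexCategory, L.obj.obj (op p) →
      (T ⟶ (M.obj (op (stdSimplexFin.obj p))).obj X)),
    (∀ ⦃p q : SimplexCategory⦄ (α : p ⟶ q) (s : L.obj.obj (op q)),
      y p (L.obj.map α.op s) = y q s ≫ (M.map (stdSimplexFin.map α).op).app X) →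
    ∃! u : T ⟶ (M.obj (op L)).obj X, ∀ (p : SimplexCategory) (s : L.obj.obj (op p)),
      u ≫ (M.map (simplexMap s).op).app X = y p s

variable {M}

lemma IsGluedFromSimplices.hom_ext {L : FinSSet.{w}} (hL : IsGluedFromSimplices M L) {X : D}
    {T : C} {u u' : T ⟶ (M.obj (op L)).obj X}
    (h : ∀ (p : SimplexCategory) (s : L.obj.obj (op p)),
      u ≫ (M.map (simplexMap s).op).app X = u' ≫ (M.map (simplexMap s).op).app X) : u = u' := by
  refine (hL (fun p s => u' ≫ (M.map (simplexMap s).op).app X) ?_).unique h (fun _ _ => rfl)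
  intro p q α s
  rw [simplexMap_map, op_comp, M.map_comp, NatTrans.comp_app, Category.assoc]

lemma map_subcomplexFinι_comp {n : ℕ} (A : (Δ[n] : SSet.{w}).Subcomplex) {p : SimplexCategory}
    (s : (subcomplexFin.{w} A).obj.obj (op p)) (X : D) :
    (M.map (subcomplexFinι A).op).app X ≫ (M.map (simplexMap s).op).app X =
      (M.map (stdSimplexFin.map (SSet.stdSimplex.objEquiv s.1)).op).app X := by
  rw [← NatTrans.comp_app, ← M.map_comp, ← op_comp, simplexMap_comp_subcomplexFinι]

lemma map_stdSimplexFin_id (p : SimplexCategory) (X : D) :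
    (M.map (stdSimplexFin.map (𝟙 p)).op).app X = 𝟙 _ := by
  have h : stdSimplexFin.{w}.map (𝟙 p) = 𝟙 _ := CategoryTheory.Functor.map_id stdSimplexFin p
  rw [h, op_id, M.map_id, NatTrans.id_app]

lemma map_stdSimplexFin_comp {p q r : SimplexCategory} (α : p ⟶ q) (β : q ⟶ r) (X : D) :
    (M.map (stdSimplexFin.map (α ≫ β)).op).app X =
      (M.map (stdSimplexFin.map β).op).app X ≫ (M.map (stdSimplexFin.map α).op).app X := by
  have h : stdSimplexFin.{w}.map (α ≫ β) = stdSimplexFin.map α ≫ stdSimplexFin.map β :=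
    CategoryTheory.Functor.map_comp stdSimplexFin α β
  rw [h, op_comp, M.map_comp, NatTrans.comp_app]

end Boundary

/-! ### The layers of the tower -/

section Layers

variable {K : Type v} [SmallCategory K] {C : Type u} [Category.{v} C] [HasLimits C]
  {D : Type u'} [Category.{v} D] {M : FinSSet.{w}ᵒᵖ ⥤ D ⥤ C} {F : Kᵒᵖ × K ⥤ D}

variable (K) in
/-- The chains of dimension `n` that do not come from lower dimensions. -/
abbrev NondegenerateChain (n : ℕ) : Type v :=
  { d : ComposableArrows K n // d ∉ skeletonChains K n ⦋n⦌ }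

lemma not_epi_of_mem_boundary {n : ℕ} {p : SimplexCategory}
    (s : (subcomplexFin.{w} ∂Δ[n]).obj.obj (op p)) :
    ¬ Epi (SSet.stdSimplex.objEquiv s.1) := by
  rw [SimplexCategory.epi_iff_surjective]
  exact s.2

namespace chainLimit

/-- For fixed `c`, pushing the components at all restrictions of `c` forward to the end points of
`c` gives a family indexed by simplices. This is its compatibility, which is what gluing over
`∂Δ[n]` requires. -/
lemma π_comp_map_endpointsMap {S : ChainSet K} {p q r : SimplexCategory} (α : p ⟶ q) (β : q ⟶ r)
    (c : ComposableArrows K r.len) (h : restrictChain β c ∈ S q)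
    (h' : restrictChain (α ≫ β) c ∈ S p) :
    π (M := M) (restrictChain (α ≫ β) c) h' ≫ (M.obj _).map (endpointsMap F (α ≫ β) c) =
      (π (restrictChain β c) h ≫ (M.obj _).map (endpointsMap F β c)) ≫
        (M.map (stdSimplexFin.map α).op).app _ := by
  rw [Category.assoc, (M.map (stdSimplexFin.map α).op).naturality,
    condition_assoc α (restrictChain β c) h h']
  exact congrArg (π (M := M) (restrictChain (α ≫ β) c) h' ≫ ·)
    ((congrArg (M.obj _).map (endpointsMap_comp F α β c)).trans (Functor.map_comp _ _ _))

/-- A simplex of `∂Δ[n]` is a non-surjective map to `⦋n⦌`, so the chain it cuts out of `d` already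
lies in the skeleton and has a component there. These components glue. -/
lemma exists_attach {n : ℕ} (hn : IsGluedFromSimplices M (subcomplexFin ∂Δ[n]))
    (d : ComposableArrows K n) :
    ∃ u : chainLimit M F (skeletonChains K n) ⟶
        (M.obj (op (subcomplexFin ∂Δ[n]))).obj (endpoints F d),
      ∀ (p : SimplexCategory) (s : (subcomplexFin.{w} ∂Δ[n]).obj.obj (op p)),
        u ≫ (M.map (simplexMap s).op).app _ =
          π (restrictChain (SSet.stdSimplex.objEquiv s.1) d)
            (restrictChain_mem_of_not_epi _ (not_epi_of_mem_boundary s) d) ≫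
            (M.obj _).map (endpointsMap F (SSet.stdSimplex.objEquiv s.1) d) := by
  refine (hn (fun p s => π (restrictChain (SSet.stdSimplex.objEquiv s.1) d)
            (restrictChain_mem_of_not_epi _ (not_epi_of_mem_boundary s) d) ≫
            (M.obj _).map (endpointsMap F (SSet.stdSimplex.objEquiv s.1) d)) ?_).exists
  intro p q α s
  exact π_comp_map_endpointsMap α (SSet.stdSimplex.objEquiv s.1) d _ _

/-- The map from the limit over the `n`-skeleton to the mapping objects out of the boundaries of
the nondegenerate `n`-chains. -/
noncomputable def attach {n : ℕ} (hn : IsGluedFromSimplices M (subcomplexFin ∂Δ[n])) :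
    chainLimit M F (skeletonChains K n) ⟶
      ∏ᶜ fun d : NondegenerateChain K n =>
        (M.obj (op (subcomplexFin ∂Δ[n]))).obj (endpoints F d.1) :=
  Pi.lift fun d => (exists_attach hn d.1).choose

lemma attach_π {n : ℕ} (hn : IsGluedFromSimplices M (subcomplexFin ∂Δ[n]))
    (d : NondegenerateChain K n) (p : SimplexCategory)
    (s : (subcomplexFin.{w} ∂Δ[n]).obj.obj (op p)) :
    attach (F := F) hn ≫ Pi.π _ d ≫ (M.map (simplexMap s).op).app _ =
      π (restrictChain (SSet.stdSimplex.objEquiv s.1) d.1)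
        (restrictChain_mem_of_not_epi _ (not_epi_of_mem_boundary s) d.1) ≫
        (M.obj _).map (endpointsMap F (SSet.stdSimplex.objEquiv s.1) d.1) := by
  rw [attach, Pi.lift_π_assoc]
  exact (exists_attach hn d.1).choose_spec p s

lemma attach_π_assoc {n : ℕ} (hn : IsGluedFromSimplices M (subcomplexFin ∂Δ[n]))
    (d : NondegenerateChain K n) (p : SimplexCategory)
    (s : (subcomplexFin.{w} ∂Δ[n]).obj.obj (op p)) {Z : C}
    (f : (M.obj (op (stdSimplexFin.obj p))).obj (endpoints F d.1) ⟶ Z) :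
    attach (F := F) hn ≫ Pi.π _ d ≫ (M.map (simplexMap s).op).app _ ≫ f =
      π (restrictChain (SSet.stdSimplex.objEquiv s.1) d.1)
        (restrictChain_mem_of_not_epi _ (not_epi_of_mem_boundary s) d.1) ≫
        (M.obj _).map (endpointsMap F (SSet.stdSimplex.objEquiv s.1) d.1) ≫ f := by
  have := congrArg (· ≫ f) (attach_π (F := F) hn d p s)
  simpa only [Category.assoc] using this

/-- The components at the nondegenerate `n`-chains. -/
noncomputable def topCells (n : ℕ) :
    chainLimit M F (skeletonChains K (n + 1)) ⟶
      ∏ᶜ fun d : NondegenerateChain K n =>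
        (M.obj (op (stdSimplexFin.obj ⦋n⦌))).obj (endpoints F d.1) :=
  Pi.lift fun d => π d.1 (mem_skeletonChains (p := ⦋n⦌) d.1 n.lt_succ_self)

variable (M F) in
/-- The restriction to the boundaries of the nondegenerate `n`-chains. -/
noncomputable def cellsBoundary (n : ℕ) :
    (∏ᶜ fun d : NondegenerateChain K n =>
        (M.obj (op (stdSimplexFin.obj ⦋n⦌))).obj (endpoints F d.1)) ⟶
      ∏ᶜ fun d : NondegenerateChain K n =>
        (M.obj (op (subcomplexFin ∂Δ[n]))).obj (endpoints F d.1) :=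
  Limits.Pi.map fun _ => (M.map (subcomplexFinι ∂Δ[n]).op).app _

lemma topCells_comp {n : ℕ} (hn : IsGluedFromSimplices M (subcomplexFin ∂Δ[n])) :
    topCells n ≫ cellsBoundary M F n =
      restrict (skeletonChains_mono n.le_succ) ≫ attach hn := by
  refine Pi.hom_ext _ _ fun d => hn.hom_ext fun p s => ?_
  simp only [Category.assoc, topCells, cellsBoundary, Limits.Pi.map_π_assoc, Pi.lift_π_assoc,
    attach_π, restrict_π_assoc, map_subcomplexFinι_comp]
  exact condition (SSet.stdSimplex.objEquiv s.1) d.1 _ _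

section Extension

variable {n : ℕ} (hn : IsGluedFromSimplices M (subcomplexFin ∂Δ[n])) {T : C}
  (a : T ⟶ chainLimit M F (skeletonChains K n))
  (z : T ⟶ ∏ᶜ fun d : NondegenerateChain K n =>
        (M.obj (op (stdSimplexFin.obj ⦋n⦌))).obj (endpoints F d.1))

/-- The simplices of `∂Δ[n]` are exactly the maps that are not epi, so commutativity of the layer
square can be read off at each such `σ`. -/
lemma boundary_condition (h : z ≫ cellsBoundary M F n = a ≫ attach hn)
    (d : NondegenerateChain K n) {p : SimplexCategory} (σ : p ⟶ ⦋n⦌) (hσ : ¬ Epi σ) :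
    z ≫ Pi.π _ d ≫ (M.map (stdSimplexFin.map σ).op).app _ =
      a ≫ π (restrictChain σ d.1) (restrictChain_mem_of_not_epi _ hσ d.1) ≫
        (M.obj _).map (endpointsMap F σ d.1) := by
  let s : (subcomplexFin.{w} ∂Δ[n]).obj.obj (op p) :=
    ⟨SSet.stdSimplex.objEquiv.symm σ, by
      rw [SimplexCategory.epi_iff_surjective] at hσ
      exact hσ⟩
  have := congrArg (· ≫ Pi.π _ d ≫ (M.map (simplexMap s).op).app _) h
  simp only [Category.assoc, cellsBoundary, Limits.Pi.map_π_assoc, attach_π,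
    map_subcomplexFinι_comp] at this
  exact this

end Extension

end chainLimit

end Layers

/-! ### The layer squares are pullbacks -/

section Layers

variable {K : Type v} [SmallCategory K] {C : Type u} [Category.{v} C] [HasLimits C]
  {D : Type u'} [Category.{v} D] {M : FinSSet.{w}ᵒᵖ ⥤ D ⥤ C} {F : Kᵒᵖ × K ⥤ D}

namespace chainLimit

section Extension

variable {n : ℕ} (hn : IsGluedFromSimplices M (subcomplexFin ∂Δ[n])) {T : C}
  (a : T ⟶ chainLimit M F (skeletonChains K n))
  (z : T ⟶ ∏ᶜ fun d : NondegenerateChain K n =>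
        (M.obj (op (stdSimplexFin.obj ⦋n⦌))).obj (endpoints F d.1))

/-- The second property ranges over all presentations of `c` as a restriction of a nondegenerate
chain, so that the chosen components do not depend on a presentation; `eqToHom` transports along the
equality of chains. -/
lemma exists_extension_component (h : z ≫ cellsBoundary M F n = a ≫ attach hn)
    {p : SimplexCategory} (c : ComposableArrows K p.len)
    (hc : c ∈ skeletonChains K (n + 1) p) :
    ∃ y : T ⟶ (M.obj (op (stdSimplexFin.obj p))).obj (endpoints F c),
      (∀ hc' : c ∈ skeletonChains K n p, y = a ≫ π c hc') ∧
      ∀ (d : NondegenerateChain K n) (σ : p ⟶ ⦋n⦌) (hσ : c = restrictChain σ d.1),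
        y ≫ (M.obj _).map (eqToHom (congrArg (endpoints F) hσ) ≫ endpointsMap F σ d.1) =
          z ≫ Pi.π _ d ≫ (M.map (stdSimplexFin.map σ).op).app _ := by
  by_cases hc' : c ∈ skeletonChains K n p
  -- An old chain: any such `σ` fails to be epi, so the value is dictated by `a` and agrees with `z`
  -- on the boundary.
  · refine ⟨a ≫ π c hc', fun _ => rfl, ?_⟩
    rintro d σ rfl
    rw [eqToHom_refl, Category.id_comp, Category.assoc,
      boundary_condition hn a z h d σ (not_epi_of_restrictChain_mem d.2 hc')]
  -- A new chain: the value is that of `z` at the unique nondegenerate chain, transported back along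
  -- the isomorphism of end points.
  · obtain ⟨σ, _, d, hd, rfl⟩ := exists_restrictChain_eq hc hc'
    refine ⟨(z ≫ Pi.π _ ⟨d, hd⟩ ≫ (M.map (stdSimplexFin.map σ).op).app _) ≫
      inv ((M.obj _).map (endpointsMap F σ d)), fun h => (hc' h).elim, ?_⟩
    rintro ⟨d', hd'⟩ σ' hσ
    obtain ⟨rfl, rfl⟩ := restrictChain_injective hd hd' hσ
    rw [eqToHom_refl, Category.id_comp, Category.assoc]
    exact (congrArg _ (IsIso.inv_hom_id _)).trans (Category.comp_id _)

lemma exists_extension (h : z ≫ cellsBoundary M F n = a ≫ attach hn) :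
    ∃ x : T ⟶ chainLimit M F (skeletonChains K (n + 1)),
      x ≫ topCells n = z ∧ x ≫ restrict (skeletonChains_mono n.le_succ) = a := by
  choose y hy₁ hy₂ using fun (p : SimplexCategory) (c : ComposableArrows K p.len)
    (hc : c ∈ skeletonChains K (n + 1) p) => exists_extension_component hn a z h c hc
  have hy₃ {p : SimplexCategory} (d : NondegenerateChain K n) (σ : p ⟶ ⦋n⦌)
      (hc : restrictChain σ d.1 ∈ skeletonChains K (n + 1) p) :
      y p (restrictChain σ d.1) hc ≫ (M.obj _).map (endpointsMap F σ d.1) =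
        z ≫ Pi.π _ d ≫ (M.map (stdSimplexFin.map σ).op).app _ := by
    simpa using hy₂ p _ hc d σ rfl
  refine ⟨lift y ?_, ?_, ?_⟩
  · intro p q α c hc hc'
    by_cases hc₀ : c ∈ skeletonChains K n q
    · rw [hy₁ q c hc hc₀, hy₁ p _ hc' (restrictChain_mem_skeletonChains α hc₀), Category.assoc,
        Category.assoc, condition]
    -- Compatibility is tested after the isomorphism to the end points of `d`, where both sides are
    -- the restriction of `z` along `α ≫ σ`. Since `hy₃` does not require an epimorphism,
    -- restrictions that fall into the skeleton need no separate case.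
    · obtain ⟨σ, _, d, hd, rfl⟩ := exists_restrictChain_eq hc hc₀
      rw [← cancel_mono ((M.obj _).map (endpointsMap F σ d)), Category.assoc, Category.assoc,
        ← (M.map (stdSimplexFin.map α).op).naturality]
      have h₁ := hy₃ ⟨d, hd⟩ σ hc
      have h₂ := hy₃ ⟨d, hd⟩ (α ≫ σ) hc'
      refine (Category.assoc _ _ _).symm.trans ((congrArg (· ≫ _) h₁).trans ?_)
      refine Eq.trans ?_ (h₂.symm.trans (congrArg (_ ≫ ·)
        ((congrArg (M.obj _).map (endpointsMap_comp F α σ d)).trans (Functor.map_comp _ _ _))))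
      rw [map_stdSimplexFin_comp, Category.assoc, Category.assoc]
  · refine Pi.hom_ext _ _ fun d => ?_
    have := hy₃ d (𝟙 _) (mem_skeletonChains (p := ⦋n⦌) d.1 n.lt_succ_self)
    rw [Category.assoc, topCells, Pi.lift_π, lift_π]
    refine Eq.trans (Eq.trans ?_ this) ?_
    · refine ((congrArg (_ ≫ ·) ((congrArg (M.obj _).map (endpointsMap_id F (p := ⦋n⦌) d.1)).trans
        (CategoryTheory.Functor.map_id _ _))).trans (Category.comp_id _)).symm
    · rw [map_stdSimplexFin_id]
      exact congrArg (z ≫ ·) (Category.comp_id _)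
  · refine hom_ext fun p c hc => ?_
    rw [Category.assoc, restrict_π, lift_π, hy₁ _ _ _ hc]

/-- The component at a new chain is determined by the one at its nondegenerate chain, through the
compatibility along the degeneracy and the isomorphism of end points. -/
lemma hom_ext_succ {x x' : T ⟶ chainLimit M F (skeletonChains K (n + 1))}
    (h₁ : x ≫ topCells n = x' ≫ topCells n)
    (h₂ : x ≫ restrict (skeletonChains_mono n.le_succ) =
      x' ≫ restrict (skeletonChains_mono n.le_succ)) : x = x' := by
  refine hom_ext fun p c hc => ?_
  by_cases hc' : c ∈ skeletonChains K n p
  · simpa using congrArg (· ≫ π c hc') h₂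
  · obtain ⟨σ, _, d, hd, rfl⟩ := exists_restrictChain_eq hc hc'
    have h₃ := congrArg (· ≫ Pi.π _ (⟨d, hd⟩ : NondegenerateChain K n)) h₁
    simp only [Category.assoc, topCells, Pi.lift_π] at h₃
    have h₄ := condition (M := M) (F := F) σ d (mem_skeletonChains (p := ⦋n⦌) d n.lt_succ_self) hc
    rw [← cancel_mono ((M.obj _).map (endpointsMap F σ d)), Category.assoc, Category.assoc]
    refine (congrArg (x ≫ ·) h₄).symm.trans (Eq.trans ?_ (congrArg (x' ≫ ·) h₄))
    exact (Category.assoc _ _ _).symm.trans ((congrArg (· ≫ _) h₃).trans (Category.assoc _ _ _))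

end Extension

/-- The `n`-th layer of the tower is a base change of the restriction to the boundaries of the
nondegenerate `n`-chains. -/
lemma isPullback_topCells {n : ℕ} (hn : IsGluedFromSimplices M (subcomplexFin ∂Δ[n])) :
    IsPullback (topCells n) (restrict (skeletonChains_mono n.le_succ)) (cellsBoundary M F n)
      (attach hn) where
  w := topCells_comp hn
  isLimit' := ⟨PullbackCone.IsLimit.mk _
    (fun s => (exists_extension hn s.snd s.fst s.condition).choose)
    (fun s => (exists_extension hn s.snd s.fst s.condition).choose_spec.1)
    (fun s => (exists_extension hn s.snd s.fst s.condition).choose_spec.2)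
    (fun s _ h₁ h₂ => hom_ext_succ
      (h₁.trans (exists_extension hn s.snd s.fst s.condition).choose_spec.1.symm)
      (h₂.trans (exists_extension hn s.snd s.fst s.condition).choose_spec.2.symm))⟩

end chainLimit

end Layers

/-! ### Relative layers -/

section Relative

variable {C : Type u} [Category.{v} C]

/-- If `A' → A` and `B' → B` are base changes of `U' → U` and `V' → V`, compatibly, then
`A' → A ×_B B'` is a base change of `U' → U ×_V V'`. -/
lemma relativeMap_mem_of_isPullback [HasPullbacks C] (P : MorphismProperty C)
    [P.IsStableUnderBaseChange] {A A' U U' B B' V V' R : C} {tA : A' ⟶ U'} {rA : A' ⟶ A}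
    {bA : U' ⟶ U} {aA : A ⟶ U} {tB : B' ⟶ V'} {rB : B' ⟶ B} {bB : V' ⟶ V} {aB : B ⟶ V}
    (sqA : IsPullback tA rA bA aA) (sqB : IsPullback tB rB bB aB)
    {φ' : A' ⟶ B'} {φ : A ⟶ B} {ψ' : U' ⟶ V'} {ψ : U ⟶ V} (hr : rA ≫ φ = φ' ≫ rB)
    (ht : tA ≫ ψ' = φ' ≫ tB) (ha : aA ≫ ψ = φ ≫ aB)
    {r₁ : R ⟶ U} {r₂ : R ⟶ V'} (sqR : IsPullback r₁ r₂ ψ bB) {ρ : U' ⟶ R} (hρ₁ : ρ ≫ r₁ = bA)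
    (hρ₂ : ρ ≫ r₂ = ψ') (hρ : P ρ) : P (pullback.lift (f := φ) (g := rB) rA φ' hr) := by
  -- The comparison `A ×_B B' ⟶ U ×_V V'`. Pasting shows that it is a base change of `aA`;
  -- cancelling that square from `sqA` leaves the required one.
  let κ : pullback φ rB ⟶ R := sqR.lift (pullback.fst φ rB ≫ aA) (pullback.snd φ rB ≫ tB) (by
    rw [Category.assoc, Category.assoc, ha, sqB.w, pullback.condition_assoc])
  have hκ₁ : κ ≫ r₁ = pullback.fst φ rB ≫ aA := sqR.lift_fst _ _ _
  have hκ₂ : κ ≫ r₂ = pullback.snd φ rB ≫ tB := sqR.lift_snd _ _ _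
  have h₁ : IsPullback κ (pullback.fst φ rB) r₁ aA := by
    refine IsPullback.of_right (h₁₂ := r₂) (h₂₂ := ψ) (v₁₃ := bB) ?_ hκ₁ sqR.flip
    rw [hκ₂, ha]
    exact (IsPullback.of_hasPullback φ rB).flip.paste_horiz sqB
  have h₂ : IsPullback tA (pullback.lift (f := φ) (g := rB) rA φ' hr) ρ κ := by
    refine IsPullback.of_bot (v₂₁ := pullback.fst φ rB) (v₂₂ := r₁) (h₃₁ := aA) ?_ ?_ h₁
    · rw [hρ₁, pullback.lift_fst]
      exact sqA
    · apply sqR.hom_ext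
      · rw [Category.assoc, Category.assoc, hρ₁, hκ₁, pullback.lift_fst_assoc, sqA.w]
      · rw [Category.assoc, Category.assoc, hρ₂, hκ₂, pullback.lift_snd_assoc, ht]
  exact P.of_isPullback h₂ hρ

/-- Products of pullback squares are pullback squares. -/
lemma isPullback_pi_map {I : Type v} [HasLimits C] {X Y Z W : I → C} {f : ∀ i, X i ⟶ Y i}
    {g : ∀ i, X i ⟶ Z i} {h : ∀ i, Y i ⟶ W i} {k : ∀ i, Z i ⟶ W i}
    (sq : ∀ i, IsPullback (f i) (g i) (h i) (k i)) :
    IsPullback (Limits.Pi.map f) (Limits.Pi.map g) (Limits.Pi.map h) (Limits.Pi.map k) where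
  w := Pi.hom_ext _ _ fun i => by simp [(sq i).w]
  isLimit' := by
    have hs (s : PullbackCone (Limits.Pi.map h) (Limits.Pi.map k)) (i : I) :
        (s.fst ≫ Pi.π _ i) ≫ h i = (s.snd ≫ Pi.π _ i) ≫ k i := by
      simpa using congrArg (· ≫ Pi.π _ i) s.condition
    refine ⟨PullbackCone.IsLimit.mk _ (fun s => Pi.lift fun i => (sq i).lift _ _ (hs s i))
      (fun s => Pi.hom_ext _ _ fun i => by simp) (fun s => Pi.hom_ext _ _ fun i => by simp)
      (fun s m h₁ h₂ => Pi.hom_ext _ _ fun i => (sq i).hom_ext ?_ ?_)⟩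
    · simpa using congrArg (· ≫ Pi.π _ i) h₁
    · simpa using congrArg (· ≫ Pi.π _ i) h₂

end Relative

section Tot

variable {K : Type v} [SmallCategory K] {C : Type u} [Category.{v} C] [HasLimits C]
  {D : Type u'} [Category.{v} D] {M : FinSSet.{w}ᵒᵖ ⥤ D ⥤ C} {F G : Kᵒᵖ × K ⥤ D}

variable (M) in
/-- The map `Map (L, X) ⟶ Map (A, X) ×_{Map (A, Y)} Map (L, Y)` induced by `i : A ⟶ L` and
`f : X ⟶ Y`. -/
noncomputable def pullbackPower {A L : FinSSet.{w}} (i : A ⟶ L) {X Y : D} (f : X ⟶ Y) :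
    (M.obj (op L)).obj X ⟶ pullback ((M.obj (op A)).map f) ((M.map i.op).app Y) :=
  pullback.lift ((M.map i.op).app X) ((M.obj (op L)).map f) ((M.map i.op).naturality f).symm

@[simp]
lemma pullbackPower_fst {A L : FinSSet.{w}} (i : A ⟶ L) {X Y : D} (f : X ⟶ Y) :
    pullbackPower M i f ≫ pullback.fst _ _ = (M.map i.op).app X :=
  pullback.lift_fst _ _ _

@[simp]
lemma pullbackPower_snd {A L : FinSSet.{w}} (i : A ⟶ L) {X Y : D} (f : X ⟶ Y) :
    pullbackPower M i f ≫ pullback.snd _ _ = (M.obj (op L)).map f :=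
  pullback.lift_snd _ _ _

namespace chainLimit

lemma attach_naturality (η : F ⟶ G) {n : ℕ}
    (hn : IsGluedFromSimplices M (subcomplexFin ∂Δ[n])) :
    attach hn ≫ (Limits.Pi.map fun d => (M.obj _).map (endpointsHom η d.1)) =
      map (skeletonChains K n) η ≫ attach hn := by
  refine Pi.hom_ext _ _ fun d => hn.hom_ext fun p s => ?_
  simp only [Category.assoc, attach_π, Limits.Pi.map_π_assoc]
  rw [(M.map (simplexMap s).op).naturality, attach_π_assoc, map_π_assoc]
  exact congrArg (_ ≫ ·) (((M.obj _).map_comp _ _).symm.trans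
    ((congrArg (M.obj _).map (endpointsMap_naturality η _ _)).trans ((M.obj _).map_comp _ _)))

/-- The layers of `F` and of `G` are compatible base changes, so the relative layer is a base change
of the product of the corner maps of `∂Δ[n] ⟶ Δ[n]`. The tower is thereby reduced to a condition on
mapping objects. -/
lemma relativeMap_mem (P : MorphismProperty C) [P.IsStableUnderBaseChange] (η : F ⟶ G) {n : ℕ}
    (hn : IsGluedFromSimplices M (subcomplexFin ∂Δ[n]))
    (hP : P (Limits.Pi.map fun d : NondegenerateChain K n =>
      pullbackPower M (subcomplexFinι ∂Δ[n]) (endpointsHom η d.1))) :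
    P (pullback.lift (f := (towerMap M η).app (op n)) (g := (tower M G).map (homOfLE n.le_succ).op)
      ((tower M F).map (homOfLE n.le_succ).op) ((towerMap M η).app (op (n + 1)))
      ((towerMap M η).naturality _)) := by
  refine relativeMap_mem_of_isPullback P (isPullback_topCells hn) (isPullback_topCells hn)
    (ψ' := Limits.Pi.map fun d => (M.obj _).map (endpointsHom η d.1))
    (ψ := Limits.Pi.map fun d => (M.obj _).map (endpointsHom η d.1))
    _ ?_ (attach_naturality η hn) (isPullback_pi_map fun d => IsPullback.of_hasPullback _ _)
    ?_ ?_ hP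
  · refine Pi.hom_ext _ _ fun d => ?_
    simp only [topCells, towerMap, Category.assoc, Limits.Pi.map_π, Pi.lift_π, Pi.lift_π_assoc]
    exact (map_π η _ _).symm
  · refine Pi.hom_ext _ _ fun d => ?_
    simp [cellsBoundary]
  · refine Pi.hom_ext _ _ fun d => ?_
    simp

end chainLimit

end Tot

/-! ### The total object as the limit of the tower -/

section Tot

variable {K : Type v} [SmallCategory K] {C : Type u} [Category.{v} C] [HasLimits C]
  {D : Type u'} [Category.{v} D] (M : FinSSet.{w}ᵒᵖ ⥤ D ⥤ C) (F G : Kᵒᵖ × K ⥤ D)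

/-- Projections that make `X` a cosimplicial replacement of `F`, in the sense that `Map (L, X^p)`
is the product of the `Map (L, F (c₀, cₚ))`, over the `p`-chains `c`. -/
structure ReplacementProjections (X : CosimplicialObject D) where
  /-- The projection to the factor of a chain. -/
  proj {p : SimplexCategory} (c : ComposableArrows K p.len) : X.obj p ⟶ endpoints F c
  naturality {p q : SimplexCategory} (α : p ⟶ q) (c : ComposableArrows K q.len) :
    X.map α ≫ proj c = proj (restrictChain α c) ≫ endpointsMap F α c
  isIso (p q : SimplexCategory) : IsIso (Pi.lift fun c : ComposableArrows K q.len =>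
    (M.obj (op (stdSimplexFin.obj p))).map (proj c))

namespace ReplacementProjections

variable {M F G} {X Y : CosimplicialObject D} (π : ReplacementProjections M F X)
  (π' : ReplacementProjections M G Y)

lemma exists_lift {p q : SimplexCategory} {T : C}
    (y : ∀ c : ComposableArrows K q.len,
      T ⟶ (M.obj (op (stdSimplexFin.obj p))).obj (endpoints F c)) :
    ∃ u : T ⟶ (M.obj (op (stdSimplexFin.obj p))).obj (X.obj q),
      ∀ c, u ≫ (M.obj _).map (π.proj c) = y c := by
  have := π.isIso p q
  refine ⟨Pi.lift y ≫ inv (Pi.lift fun c => (M.obj _).map (π.proj c)), fun c => ?_⟩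
  have h : (M.obj (op (stdSimplexFin.obj p))).map (π.proj c) =
    (Pi.lift fun c => (M.obj _).map (π.proj c)) ≫ Pi.π _ c := by rw [Pi.lift_π]
  rw [h, Category.assoc, IsIso.inv_hom_id_assoc, Pi.lift_π]

lemma hom_ext {p q : SimplexCategory} {T : C}
    {u u' : T ⟶ (M.obj (op (stdSimplexFin.obj p))).obj (X.obj q)}
    (h : ∀ c : ComposableArrows K q.len,
      u ≫ (M.obj _).map (π.proj c) = u' ≫ (M.obj _).map (π.proj c)) : u = u' := by
  have := π.isIso p q
  rw [← cancel_mono (Pi.lift fun c => (M.obj _).map (π.proj c))]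
  refine Pi.hom_ext _ _ fun c => ?_
  rw [Category.assoc, Category.assoc, Pi.lift_π, h]

variable (M X) in
/-- The projection of the total object to `Map (Δ[p], X^p)`. -/
noncomputable def totπ (p : SimplexCategory) :
    tot M X ⟶ (M.obj (op (stdSimplexFin.obj p))).obj (X.obj p) :=
  end_.π (totBifunctor M X) p

lemma totπ_condition {p q : SimplexCategory} (α : p ⟶ q) :
    totπ M X p ≫ (M.obj _).map (X.map α) =
      totπ M X q ≫ (M.map (stdSimplexFin.map α).op).app _ :=
  end_.condition (totBifunctor M X) α

lemma tot_hom_ext {T : C} {f g : T ⟶ tot M X} (h : ∀ p, f ≫ totπ M X p = g ≫ totπ M X p) :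
    f = g :=
  end_.hom_ext h

/-- The map to the total object given by a compatible family of maps. -/
noncomputable def totLift {T : C}
    (x : ∀ p : SimplexCategory, T ⟶ (M.obj (op (stdSimplexFin.obj p))).obj (X.obj p))
    (hx : ∀ ⦃p q : SimplexCategory⦄ (α : p ⟶ q), x p ≫ (M.obj _).map (X.map α) =
      x q ≫ (M.map (stdSimplexFin.map α).op).app _) : T ⟶ tot M X :=
  end_.lift (F := totBifunctor M X) x hx

lemma totLift_π {T : C}
    (x : ∀ p : SimplexCategory, T ⟶ (M.obj (op (stdSimplexFin.obj p))).obj (X.obj p))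
    (hx : ∀ ⦃p q : SimplexCategory⦄ (α : p ⟶ q), x p ≫ (M.obj _).map (X.map α) =
      x q ≫ (M.map (stdSimplexFin.map α).op).app _) (p : SimplexCategory) :
    totLift x hx ≫ totπ M X p = x p :=
  end_.lift_π _ _ _

lemma totπ_comp_map {p q : SimplexCategory} (α : p ⟶ q) (c : ComposableArrows K q.len) :
    (totπ M X q ≫ (M.obj _).map (π.proj c)) ≫ (M.map (stdSimplexFin.map α).op).app _ =
      (totπ M X p ≫ (M.obj _).map (π.proj (restrictChain α c))) ≫
        (M.obj _).map (endpointsMap F α c) := by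
  rw [Category.assoc, Category.assoc, ← Functor.map_comp, ← π.naturality,
    (M.map (stdSimplexFin.map α).op).naturality, Functor.map_comp]
  have := congrArg (· ≫ (M.obj _).map (π.proj c)) (totπ_condition (M := M) (X := X) α)
  simp only [Category.assoc] at this
  exact this.symm

/-- The map from the total object to the limit over a set of chains. -/
noncomputable def totToChainLimit (S : ChainSet K) : tot M X ⟶ chainLimit M F S :=
  chainLimit.lift (fun p c _ => totπ M X p ≫ (M.obj _).map (π.proj c))
    (fun _ _ α c _ _ => π.totπ_comp_map α c)

@[simp]
lemma totToChainLimit_π (S : ChainSet K) {p : SimplexCategory} (c : ComposableArrows K p.len)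
    (hc : c ∈ S p) :
    π.totToChainLimit S ≫ chainLimit.π c hc = totπ M X p ≫ (M.obj _).map (π.proj c) :=
  chainLimit.lift_π _ _ _ _

/-- The total object, as a cone over the tower. -/
noncomputable def totCone : Cone (chainLimit.tower M F) where
  pt := tot M X
  π :=
    { app n := π.totToChainLimit (skeletonChains K n.unop)
      naturality n n' f := by
        refine (Category.id_comp _).trans (chainLimit.hom_ext fun p c hc => ?_)
        simp [chainLimit.tower] }

/-- The component of a cone at a chain is the same at every stage that contains the chain. -/
lemma cone_comp_π (s : Cone (chainLimit.tower M F)) {p : SimplexCategory}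
    (c : ComposableArrows K p.len) {n n' : ℕ} (h : n ≤ n') (hc : c ∈ skeletonChains K n p) :
    s.π.app (op n) ≫ chainLimit.π (M := M) (F := F) c hc =
      s.π.app (op n') ≫ chainLimit.π (M := M) (F := F) c (skeletonChains_mono h p hc) := by
  rw [← s.w (homOfLE h).op]
  exact (Category.assoc _ _ _).trans (congrArg (_ ≫ ·) (chainLimit.restrict_π _ c _))

lemma exists_totLift (s : Cone (chainLimit.tower M F)) (p : SimplexCategory) :
    ∃ u : s.pt ⟶ (M.obj (op (stdSimplexFin.obj p))).obj (X.obj p),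
      ∀ (c : ComposableArrows K p.len) (n : ℕ) (hc : c ∈ skeletonChains K n p),
        u ≫ (M.obj _).map (π.proj c) = s.π.app (op n) ≫ chainLimit.π (M := M) (F := F) c hc := by
  -- Stage `p.len + 1` contains all chains of dimension `p`. It is compared with stage `n` through
  -- the larger of the two.
  obtain ⟨u, hu⟩ := π.exists_lift (p := p) (fun c => s.π.app (op (p.len + 1)) ≫
    chainLimit.π (M := M) (F := F) c (mem_skeletonChains c p.len.lt_succ_self))
  exact ⟨u, fun c n hc => (hu c).trans
    ((cone_comp_π s c (le_max_right n (p.len + 1)) _).trans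
      (cone_comp_π s c (le_max_left n (p.len + 1)) hc).symm)⟩

/-- The map to the total object given by a cone over the tower. -/
noncomputable def totConeLift (s : Cone (chainLimit.tower M F)) : s.pt ⟶ tot M X :=
  totLift (fun p => (π.exists_totLift s p).choose) (fun p q α => by
    refine π.hom_ext (p := p) (q := q) fun c => ?_
    have hc := mem_skeletonChains c q.len.lt_succ_self
    have hc' := restrictChain_mem_skeletonChains α hc
    have h₁ := (π.exists_totLift s p).choose_spec (restrictChain α c) _ hc'
    have h₂ := (π.exists_totLift s q).choose_spec c _ hc
    rw [Category.assoc, Category.assoc, ← Functor.map_comp, π.naturality,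
      ← (M.map (stdSimplexFin.map α).op).naturality, Functor.map_comp, ← Category.assoc, h₁,
      ← Category.assoc, h₂]
    exact (Category.assoc _ _ _).trans ((congrArg (_ ≫ ·)
      (chainLimit.condition α c hc hc').symm).trans (Category.assoc _ _ _).symm))

lemma totConeLift_comp (s : Cone (chainLimit.tower M F)) {p : SimplexCategory}
    (c : ComposableArrows K p.len) {n : ℕ} (hc : c ∈ skeletonChains K n p) :
    (π.totConeLift s ≫ totπ M X p) ≫ (M.obj _).map (π.proj c) =
      s.π.app (op n) ≫ chainLimit.π (M := M) (F := F) c hc := by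
  rw [totConeLift, totLift_π]
  exact (π.exists_totLift s p).choose_spec c n hc

/-- The total object is the limit of the tower. -/
noncomputable def isLimitTotCone : IsLimit π.totCone where
  lift := π.totConeLift
  fac s n := by
    refine chainLimit.hom_ext fun p c hc => ?_
    refine Eq.trans ?_ (π.totConeLift_comp s c hc)
    exact (Category.assoc _ _ _).trans ((congrArg (_ ≫ ·)
      (π.totToChainLimit_π _ c hc)).trans (Category.assoc _ _ _).symm)
  uniq s m hm := by
    refine tot_hom_ext fun p => π.hom_ext (p := p) (q := p) fun c => ?_
    have hc := mem_skeletonChains c p.len.lt_succ_self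
    rw [π.totConeLift_comp s c hc, ← hm]
    exact ((Category.assoc _ _ _).trans (congrArg (m ≫ ·)
      (π.totToChainLimit_π _ c _).symm)).trans (Category.assoc _ _ _).symm

variable {π π'} in
lemma totMap_comp_totToChainLimit {η : F ⟶ G} {f : X ⟶ Y}
    (hf : ∀ (p : SimplexCategory) (c : ComposableArrows K p.len),
      f.app p ≫ π'.proj c = π.proj c ≫ endpointsHom η c) (S : ChainSet K) :
    totMap M f ≫ π'.totToChainLimit S = π.totToChainLimit S ≫ chainLimit.map S η := by
  refine chainLimit.hom_ext fun p c hc => ?_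
  have h : totMap M f ≫ totπ M Y p = totπ M X p ≫ (M.obj _).map (f.app p) := end_.map_π _ _
  rw [Category.assoc, Category.assoc, chainLimit.map_π, totToChainLimit_π, ← Category.assoc, h,
    ← Category.assoc, totToChainLimit_π, Category.assoc, Category.assoc, ← Functor.map_comp,
    ← Functor.map_comp, ← hf]

/-- The class `P` of maps is stable under limits of those towers that start with terminal objects
and whose transition maps are in `Q`. -/
def _root_.IsStableUnderTowers (P Q : MorphismProperty C) : Prop :=
  ∀ ⦃A B : ℕᵒᵖ ⥤ C⦄ (f : A ⟶ B), IsTerminal (A.obj (op 0)) → IsTerminal (B.obj (op 0)) →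
    (∀ n : ℕ, Q (A.map (homOfLE n.le_succ).op)) → (∀ n : ℕ, Q (B.map (homOfLE n.le_succ).op)) →
    (∀ n : ℕ, P (pullback.lift (f := f.app (op n)) (g := B.map (homOfLE n.le_succ).op)
      (A.map (homOfLE n.le_succ).op) (f.app (op (n + 1))) (f.naturality _))) →
    P (limMap f)

variable {π π'} in
-- The common core of both cases. `P` is the class to be proved for the map of total objects; `Q`
-- records what the tower argument needs of the transition maps: fibrations in a right model
-- category, nothing for a lifting property.
theorem totMap_mem (P Q : MorphismProperty C) [P.IsStableUnderBaseChange]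
    [Q.IsStableUnderBaseChange] (hPQ : IsStableUnderTowers P Q)
    (hM : ∀ n : ℕ, IsGluedFromSimplices M (subcomplexFin ∂Δ[n])) {η : F ⟶ G} {f : X ⟶ Y}
    (hf : ∀ (p : SimplexCategory) (c : ComposableArrows K p.len),
      f.app p ≫ π'.proj c = π.proj c ≫ endpointsHom η c)
    (hF : ∀ n, Q (chainLimit.cellsBoundary M F n)) (hG : ∀ n, Q (chainLimit.cellsBoundary M G n))
    (hP : ∀ n, P (Limits.Pi.map fun d : NondegenerateChain K n =>
      pullbackPower M (subcomplexFinι ∂Δ[n]) (endpointsHom η d.1))) :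
    P (totMap M f) := by
  have h := hPQ (chainLimit.towerMap M η) (chainLimit.isTerminalTowerZero M F)
    (chainLimit.isTerminalTowerZero M G)
    (fun n => Q.of_isPullback (chainLimit.isPullback_topCells (hM n)) (hF n))
    (fun n => Q.of_isPullback (chainLimit.isPullback_topCells (hM n)) (hG n))
    (fun n => chainLimit.relativeMap_mem P η (hM n) (hP n))
  refine (P.arrow_mk_iso_iff (Arrow.isoMk
    (π.isLimitTotCone.conePointUniqueUpToIso (limit.isLimit _))
    (π'.isLimitTotCone.conePointUniqueUpToIso (limit.isLimit _)) ?_)).2 h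
  refine limit.hom_ext fun n => ?_
  have h₁ : (π.isLimitTotCone.conePointUniqueUpToIso (limit.isLimit _)).hom ≫ limit.π _ n =
    π.totToChainLimit _ := IsLimit.conePointUniqueUpToIso_hom_comp _ _ _
  have h₂ : (π'.isLimitTotCone.conePointUniqueUpToIso (limit.isLimit _)).hom ≫ limit.π _ n =
    π'.totToChainLimit _ := IsLimit.conePointUniqueUpToIso_hom_comp _ _ _
  simp only [Arrow.mk_hom, Category.assoc, limMap_π]
  refine Eq.trans ?_ ((totMap_comp_totToChainLimit hf _).symm.trans
    (congrArg (totMap M f ≫ ·) h₂.symm))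
  exact (Category.assoc _ _ _).symm.trans (congrArg (· ≫ chainLimit.map _ η) h₁)

end ReplacementProjections

end Tot

/-! ### Gluing mapping objects along pushouts -/

section Gluing

lemma simplexMap_comp {L L' : FinSSet.{w}} (f : L ⟶ L') {p : SimplexCategory}
    (s : L.obj.obj (op p)) : simplexMap s ≫ f = simplexMap (f.hom.app (op p) s) := by
  apply ObjectProperty.hom_ext
  exact SSet.yonedaEquiv_symm_comp s f.hom

lemma simplexMap_objEquiv_symm {p q : SimplexCategory} (α : q ⟶ p) :
    simplexMap (L := stdSimplexFin.{w}.obj p) (SSet.stdSimplex.objEquiv.symm α) =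
      stdSimplexFin.map α := by
  apply ObjectProperty.hom_ext
  exact (Equiv.symm_apply_eq _).2 (SSet.yonedaEquiv_map α).symm

variable {C : Type u} [Category.{v} C] {D : Type u'} [Category.{v} D]
  {M : FinSSet.{w}ᵒᵖ ⥤ D ⥤ C}

lemma map_simplexMap_comp {L L' : FinSSet.{w}} (f : L ⟶ L') {p : SimplexCategory}
    (s : L.obj.obj (op p)) (X : D) :
    (M.map f.op).app X ≫ (M.map (simplexMap s).op).app X =
      (M.map (simplexMap (f.hom.app (op p) s)).op).app X := by
  rw [← NatTrans.comp_app, ← M.map_comp, ← op_comp, simplexMap_comp]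

/-- Yoneda: every simplex of `Δ[p]` is a restriction of the identity simplex. -/
lemma isGluedFromSimplices_stdSimplex (p : SimplexCategory) :
    IsGluedFromSimplices M (stdSimplexFin.{w}.obj p) := by
  intro X T y hy
  let i : (stdSimplexFin.{w}.obj p).obj.obj (op p) := SSet.stdSimplex.objEquiv.symm (𝟙 p)
  refine ⟨y p i, fun q s => ?_, fun u hu => ?_⟩
  · obtain ⟨α, rfl⟩ := SSet.stdSimplex.objEquiv.symm.surjective s
    refine Eq.trans ?_ ((hy α i).symm.trans (congrArg (y q) ?_))
    · rw [simplexMap_objEquiv_symm]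
    · exact (SSet.stdSimplex.map_objEquiv_symm (𝟙 p) α.op).trans
        (congrArg _ (Category.comp_id α))
  · rw [← hu p i]
    change u = u ≫ (M.map (simplexMap (SSet.stdSimplex.objEquiv.symm (𝟙 p))).op).app X
    rw [simplexMap_objEquiv_symm, map_stdSimplexFin_id]
    exact (Category.comp_id u).symm

lemma IsGluedFromSimplices.of_iso {L L' : FinSSet.{w}} (hL : IsGluedFromSimplices M L)
    (e : L ≅ L') : IsGluedFromSimplices M L' := by
  intro X T y hy
  have he (p : SimplexCategory) (s : L'.obj.obj (op p)) :
      e.hom.hom.app (op p) (e.inv.hom.app (op p) s) = s :=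
    congrArg (fun f : L' ⟶ L' => f.hom.app (op p) s) e.inv_hom_id
  obtain ⟨u, hu, hu'⟩ := hL (fun p s => y p (e.hom.hom.app (op p) s)) (fun p q α s => by
    rw [← hy]
    exact congrArg (y p) (NatTrans.naturality_apply e.hom.hom α.op s))
  refine ⟨u ≫ (M.map e.inv.op).app X, fun p s => ?_, fun v hv => ?_⟩
  · rw [Category.assoc, map_simplexMap_comp, hu, he]
  · rw [← hu' (v ≫ (M.map e.hom.op).app X) (fun p s => by
      rw [Category.assoc, map_simplexMap_comp, hv]), Category.assoc, ← NatTrans.comp_app,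
      ← M.map_comp, ← op_comp, e.inv_hom_id, op_id, M.map_id, NatTrans.id_app, Category.comp_id]

variable (M) in
/-- The mapping objects send the initial object to the terminal object, and pushouts along
injections to pullbacks. -/
structure SendsPushoutsToPullbacks : Prop where
  initial (L : FinSSet.{w}) (hL : Nonempty (IsInitial L.obj)) (X : D) :
    Nonempty (IsTerminal ((M.obj (op L)).obj X))
  pushout {A L A' L' : FinSSet.{w}} {i : A ⟶ L} {f : A ⟶ A'} {f' : L ⟶ L'} {i' : A' ⟶ L'}
    (sq : IsPushout i.hom f.hom f'.hom i'.hom) [Mono i.hom] (X : D) :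
    IsPullback ((M.map f'.op).app X) ((M.map i'.op).app X)
      ((M.map i.op).app X) ((M.map f.op).app X)

namespace SendsPushoutsToPullbacks

lemma isGluedFromSimplices_bot (hM : SendsPushoutsToPullbacks M) (n : ℕ) :
    IsGluedFromSimplices M (subcomplexFin (⊥ : (Δ[n] : SSet.{w}).Subcomplex)) := by
  intro X T y hy
  obtain ⟨h⟩ := hM.initial (subcomplexFin (⊥ : (Δ[n] : SSet.{w}).Subcomplex))
    ⟨SSet.Subcomplex.isInitialBot⟩ X
  exact ⟨h.from _, fun p s => s.2.elim, fun _ _ => h.hom_ext _ _⟩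

/-- Mayer–Vietoris: a union is the pushout over the intersection, and each simplex of the union lies
in one of the two pieces. Gluing over `A ⊓ B` ensures that the two partial maps agree there. -/
lemma isGluedFromSimplices_sup (hM : SendsPushoutsToPullbacks M)
    {n : ℕ} {A B : (Δ[n] : SSet.{w}).Subcomplex}
    (hA : IsGluedFromSimplices M (subcomplexFin A)) (hB : IsGluedFromSimplices M (subcomplexFin B))
    (hAB : IsGluedFromSimplices M (subcomplexFin (A ⊓ B))) :
    IsGluedFromSimplices M (subcomplexFin (A ⊔ B)) := by
  intro X T y hy
  let i : subcomplexFin (A ⊓ B) ⟶ subcomplexFin A :=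
    ObjectProperty.homMk (SSet.Subcomplex.homOfLE inf_le_left)
  let f : subcomplexFin (A ⊓ B) ⟶ subcomplexFin B :=
    ObjectProperty.homMk (SSet.Subcomplex.homOfLE inf_le_right)
  let f' : subcomplexFin A ⟶ subcomplexFin (A ⊔ B) :=
    ObjectProperty.homMk (SSet.Subcomplex.homOfLE le_sup_left)
  let i' : subcomplexFin B ⟶ subcomplexFin (A ⊔ B) :=
    ObjectProperty.homMk (SSet.Subcomplex.homOfLE le_sup_right)
  have sq : IsPushout i.hom f.hom f'.hom i'.hom :=
    SSet.Subcomplex.BicartSq.isPushout ⟨rfl, rfl⟩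
  have : Mono i.hom := inferInstanceAs (Mono (SSet.Subcomplex.homOfLE inf_le_left))
  have hpb := hM.pushout sq X
  have hcov (p : SimplexCategory) (s : (subcomplexFin (A ⊔ B)).obj.obj (op p)) :
      (∃ t, f'.hom.app (op p) t = s) ∨ ∃ t, i'.hom.app (op p) t = s := by
    obtain ⟨s, hs | hs⟩ := s
    · exact Or.inl ⟨⟨s, hs⟩, rfl⟩
    · exact Or.inr ⟨⟨s, hs⟩, rfl⟩
  obtain ⟨a, ha, -⟩ := hA (fun p s => y p (f'.hom.app (op p) s)) (fun p q α s => by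
    rw [← hy]; rfl)
  obtain ⟨b, hb, -⟩ := hB (fun p s => y p (i'.hom.app (op p) s)) (fun p q α s => by
    rw [← hy]; rfl)
  have hab : a ≫ (M.map i.op).app X = b ≫ (M.map f.op).app X := by
    refine hAB.hom_ext fun p s => ?_
    rw [Category.assoc, Category.assoc, map_simplexMap_comp, map_simplexMap_comp, ha, hb]
    rfl
  refine ⟨hpb.lift a b hab, fun p s => ?_, fun v hv => hpb.hom_ext ?_ ?_⟩
  · obtain ⟨t, rfl⟩ | ⟨t, rfl⟩ := hcov p s
    · rw [← map_simplexMap_comp, ← Category.assoc, hpb.lift_fst, ha]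
    · rw [← map_simplexMap_comp, ← Category.assoc, hpb.lift_snd, hb]
  · refine hA.hom_ext fun p s => ?_
    rw [Category.assoc, map_simplexMap_comp, hv, hpb.lift_fst, ha]
  · refine hB.hom_ext fun p s => ?_
    rw [Category.assoc, map_simplexMap_comp, hv, hpb.lift_snd, hb]

/-- A face on `m + 1` vertices is a copy of `Δ[m]`, and the face on no vertices is empty. -/
lemma isGluedFromSimplices_face (hM : SendsPushoutsToPullbacks M)
    {n : ℕ} (S : Finset (Fin (n + 1))) :
    IsGluedFromSimplices M (subcomplexFin (SSet.stdSimplex.face.{w} S)) := by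
  obtain rfl | hS := S.eq_empty_or_nonempty
  · rw [SSet.stdSimplex.face_empty]
    exact hM.isGluedFromSimplices_bot n
  · obtain ⟨m, hm⟩ : ∃ m, S.card = m + 1 := Nat.exists_eq_succ_of_ne_zero hS.card_ne_zero
    let e := SSet.stdSimplex.isoOfRepresentableBy.{w}
      (SSet.stdSimplex.faceRepresentableBy S m (S.orderIsoOfFin hm))
    exact (isGluedFromSimplices_stdSimplex ⦋m⦌).of_iso
      (finiteSSets.{w}.isoMk (X := stdSimplexFin.obj ⦋m⦌)
        (Y := subcomplexFin (SSet.stdSimplex.face.{w} S)) e)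

/-- Induction on the number of faces. A face meets a union of faces in a union of equally many
smaller faces, so the family `S` has to vary in the induction. -/
lemma isGluedFromSimplices_iSup_face (hM : SendsPushoutsToPullbacks M)
    {n : ℕ} {I : Type} (s : Finset I)
    (S : I → Finset (Fin (n + 1))) :
    IsGluedFromSimplices M (subcomplexFin (⨆ i ∈ s, SSet.stdSimplex.face.{w} (S i))) := by
  classical
  induction s using Finset.induction_on generalizing S with
  | empty =>
    rw [show (⨆ i ∈ (∅ : Finset I), SSet.stdSimplex.face.{w} (S i)) = ⊥ by simp]
    exact hM.isGluedFromSimplices_bot n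
  | insert i s _ ih =>
    rw [Finset.iSup_insert]
    refine hM.isGluedFromSimplices_sup (hM.isGluedFromSimplices_face _) (ih S) ?_
    have : SSet.stdSimplex.face.{w} (S i) ⊓ ⨆ j ∈ s, SSet.stdSimplex.face.{w} (S j) =
        ⨆ j ∈ s, SSet.stdSimplex.face.{w} (S i ⊓ S j) := by
      simp only [← SSet.stdSimplex.face_inter_face]
      ext p x
      simp only [Subfunctor.min_obj, Subfunctor.iSup_obj, Set.mem_inter_iff,
        Set.mem_iUnion]
      grind
    rw [this]
    exact ih _

lemma isGluedFromSimplices_boundary (hM : SendsPushoutsToPullbacks M) (n : ℕ) :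
    IsGluedFromSimplices M (subcomplexFin.{w} ∂Δ[n]) := by
  rw [SSet.boundary_eq_iSup]
  simpa using hM.isGluedFromSimplices_iSup_face Finset.univ (fun i : Fin (n + 1) => {i}ᶜ)

end SendsPushoutsToPullbacks

end Gluing

/-! ### Right enriched right model categories -/

section

variable {C : Type u} [Category.{v} C] [HasLimits C]

/-- The map at stage `n + 1` is the relative map followed by a base change of the map at stage `n`;
at stage `0` it is an isomorphism of terminal objects. -/
lemma towerMap_mem (P : MorphismProperty C) [P.IsStableUnderBaseChange]
    [P.IsStableUnderComposition] (hP : MorphismProperty.isomorphisms C ≤ P) {A B : ℕᵒᵖ ⥤ C}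
    (f : A ⟶ B) (hA : IsTerminal (A.obj (op 0))) (hB : IsTerminal (B.obj (op 0)))
    (hf : ∀ n : ℕ, P (pullback.lift (f := f.app (op n)) (g := B.map (homOfLE n.le_succ).op)
      (A.map (homOfLE n.le_succ).op) (f.app (op (n + 1))) (f.naturality _))) (n : ℕ) :
    P (f.app (op n)) := by
  induction n with
  | zero => exact hP _ ⟨hB.from _ ≫ hA.from _, hA.hom_ext _ _, hB.hom_ext _ _⟩
  | succ n ih =>
    have h := P.comp_mem _ _ (hf n) (P.of_isPullback (IsPullback.of_hasPullback _ _) ih)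
    rwa [pullback.lift_snd] at h

/-- The total object is terminal if its factors are. -/
noncomputable def isTerminalTot {D : Type u'} [Category.{v} D] {M : FinSSet.{w}ᵒᵖ ⥤ D ⥤ C}
    {X : CosimplicialObject D}
    (h : ∀ p q, IsTerminal ((M.obj (op (stdSimplexFin.obj p))).obj (X.obj q))) :
    IsTerminal (tot M X) :=
  IsTerminal.ofUniqueHom
    (fun _ => ReplacementProjections.totLift (fun p => (h p p).from _)
      (fun p q _ => (h p q).hom_ext _ _))
    (fun _ _ => ReplacementProjections.tot_hom_ext fun p => (h p p).hom_ext _ _)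

/-- A product of terminal objects is terminal. -/
noncomputable def isTerminalPi {I : Type v} {X : I → C} (h : ∀ i, IsTerminal (X i)) :
    IsTerminal (∏ᶜ X) :=
  IsTerminal.ofUniqueHom (fun _ => Pi.lift fun i => (h i).from _)
    (fun _ _ => Pi.hom_ext _ _ fun i => (h i).hom_ext _ _)

end

/-! ### Towers in a right model category -/

namespace RightModelCategory

variable (C : Type u) [Category.{v} C] [CategoryWithFibrations C] [CategoryWithWeakEquivalences C]
  [RightModelCategory C]

instance : (fibrations C).IsStableUnderComposition := fibrations_comp

instance : (weakEquivalences C).HasTwoOutOfThreeProperty := saturated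

instance : (fibrations C).IsStableUnderBaseChange where
  of_isPullback sq hg := by
    rw [← fibration_iff] at hg ⊢
    exact rm1_fibration sq

instance : (trivialFibrations C).IsStableUnderBaseChange where
  of_isPullback sq hg := by
    obtain ⟨h₁, h₂⟩ := hg
    rw [← fibration_iff] at h₁
    rw [← weakEquivalence_iff] at h₂
    exact ⟨(fibration_iff _).1 (rm1_fibration sq),
      (weakEquivalence_iff _).1 (rm1_weakEquivalence_fibration sq)⟩

instance : (trivialFibrations C).IsStableUnderComposition :=
  inferInstanceAs (fibrations C ⊓ weakEquivalences C).IsStableUnderComposition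

lemma isomorphisms_le_trivialFibrations :
    MorphismProperty.isomorphisms C ≤ trivialFibrations C :=
  le_inf isomorphisms_le_fibrations isomorphisms_le_weakEquivalences

variable {C} [HasLimits C]

lemma isFibrant_of_isTerminal {X : C} (hX : IsTerminal X) : IsFibrant X := by
  rw [isFibrant_iff, fibration_iff]
  exact isomorphisms_le_fibrations _
    ⟨hX.from _, hX.hom_ext _ _, terminalIsTerminal.hom_ext _ _⟩

lemma isTowerFibration {A B : ℕᵒᵖ ⥤ C} (f : A ⟶ B) (hA : IsTerminal (A.obj (op 0)))
    (hB : IsTerminal (B.obj (op 0)))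
    (hA' : ∀ n : ℕ, fibrations C (A.map (homOfLE n.le_succ).op))
    (hB' : ∀ n : ℕ, fibrations C (B.map (homOfLE n.le_succ).op))
    (hf : ∀ n : ℕ, fibrations C (pullback.lift (f := f.app (op n))
      (g := B.map (homOfLE n.le_succ).op)
      (A.map (homOfLE n.le_succ).op) (f.app (op (n + 1))) (f.naturality _))) :
    IsTowerFibration f where
  isFibrant_source := isFibrant_of_isTerminal hA
  isFibrant_target := isFibrant_of_isTerminal hB
  fibration_source n := (fibration_iff _).2 (hA' n)
  fibration_target n := (fibration_iff _).2 (hB' n)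
  fibration_zero := (fibration_iff _).2
    (towerMap_mem _ isomorphisms_le_fibrations f hA hB hf 0)
  fibration_succ n := (fibration_iff _).2 (hf n)

lemma isStableUnderTowers_fibrations (h : TowersPreserveFibrations C) :
    IsStableUnderTowers (fibrations C) (fibrations C) := fun _ _ f hA hB hA' hB' hf =>
  (fibration_iff _).1 (h.fibration f (isTowerFibration f hA hB hA' hB' hf))

/-- The tower axiom asks for weak equivalences at every stage; these follow inductively from the
relative maps being trivial fibrations. -/
lemma isStableUnderTowers_trivialFibrations (h : TowersPreserveFibrations C) :
    IsStableUnderTowers (trivialFibrations C) (fibrations C) := fun _ _ f hA hB hA' hB' hf => by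
  have hf' := isTowerFibration f hA hB hA' hB' (fun n => (hf n).1)
  exact ⟨(fibration_iff _).1 (h.fibration f hf'), (weakEquivalence_iff _).1
    (h.weakEquivalence f hf' fun n => (weakEquivalence_iff _).2
      (towerMap_mem _ (isomorphisms_le_trivialFibrations C) f hA hB hf n).2)⟩

end RightModelCategory

/-! ### Homotopy ends in a right enriched right model category -/

namespace RightEnrichment

variable {K : Type v} [SmallCategory K] {C : Type u} [Category.{v} C] [HasLimits C]
  [CategoryWithFibrations C] [CategoryWithWeakEquivalences C] (E : RightEnrichment.{w} C)

/-- The mapping objects, with values in `C`. -/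
abbrev mapping : FinSSet.{w}ᵒᵖ ⥤ FibrantObject C ⥤ C :=
  E.Map ⋙ (Functor.whiskeringRight _ _ _).obj FibrantObject.ι

lemma sendsPushoutsToPullbacks : SendsPushoutsToPullbacks E.mapping where
  initial := E.re2_initial
  pushout sq _ X := E.re2_pushout sq X

/-- The factors of the cosimplicial replacement. -/
noncomputable def replacementProjections (F : Kᵒᵖ × K ⥤ FibrantObject C) :
    ReplacementProjections E.mapping F (E.cosimplicialReplacement F) where
  proj {p} c := ObjectProperty.homMk
    (Pi.π (fun c : ComposableArrows K p.len => (endpoints F c).obj) c)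
  naturality _ _ := ObjectProperty.hom_ext _ (Pi.lift_π _ _)
  isIso p q := E.re5_iso (fun c : ComposableArrows K q.len => endpoints F c) (stdSimplexFin.obj p)

lemma replacementProjections_naturality {F G : Kᵒᵖ × K ⥤ FibrantObject C} (η : F ⟶ G)
    (p : SimplexCategory) (c : ComposableArrows K p.len) :
    (E.cosimplicialReplacementMap η).app p ≫ (E.replacementProjections G).proj c =
      (E.replacementProjections F).proj c ≫ endpointsHom η c :=
  ObjectProperty.hom_ext _ (Limits.Pi.map_π (fun c : ComposableArrows K p.len =>
    (endpointsHom η c).hom) c)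

lemma fibrations_cellsBoundary (hprod : ProductsPreserveFibrations C)
    (F : Kᵒᵖ × K ⥤ FibrantObject C) (n : ℕ) :
    fibrations C (chainLimit.cellsBoundary E.mapping F n) :=
  (fibration_iff _).1 (hprod.fibration _
    (fun d => ((E.Map.obj (op (subcomplexFin ∂Δ[n]))).obj (endpoints F d.1)).property)
    (fun _ => E.re2_fibration _ _))

variable [RightModelCategory C]

/-- The target of a corner map is fibered over `Map (L, Y)`. Its fibrancy is needed because products
are only assumed to preserve fibrations with fibrant targets. -/
lemma isFibrant_pullback {A L : FinSSet.{w}} (i : A ⟶ L) {X Y : FibrantObject C} (f : X ⟶ Y)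
    [Fibration f.hom] :
    IsFibrant (pullback ((E.mapping.obj (op A)).map f) ((E.mapping.map i.op).app Y)) := by
  have h₁ : Fibration ((E.mapping.obj (op A)).map f) := E.re1_fibration A f
  have h₂ : IsFibrant ((E.mapping.obj (op L)).obj Y) := ((E.Map.obj (op L)).obj Y).property
  have h₃ : Fibration (pullback.snd ((E.mapping.obj (op A)).map f) ((E.mapping.map i.op).app Y)) :=
    RightModelCategory.rm1_fibration (IsPullback.of_hasPullback _ _)
  exact isFibrant_of_fibration
    (pullback.snd ((E.mapping.obj (op A)).map f) ((E.mapping.map i.op).app Y))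

theorem fibration_homotopyEndMap (hprod : ProductsPreserveFibrations C)
    (htower : TowersPreserveFibrations C) {F G : Kᵒᵖ × K ⥤ FibrantObject C} (η : F ⟶ G)
    (hη : ∀ x y : K, Fibration (η.app (op x, y)).hom) : Fibration (E.homotopyEndMap η) := by
  rw [fibration_iff]
  have (n : ℕ) (d : ComposableArrows K n) : Fibration (endpointsHom η d).hom := hη _ _
  exact ReplacementProjections.totMap_mem _ _
    (RightModelCategory.isStableUnderTowers_fibrations htower)
    E.sendsPushoutsToPullbacks.isGluedFromSimplices_boundary
    (E.replacementProjections_naturality η) (E.fibrations_cellsBoundary hprod F)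
    (E.fibrations_cellsBoundary hprod G)
    (fun n => (fibration_iff _).1 (hprod.fibration _ (fun d => E.isFibrant_pullback _ _)
      (fun d => E.re3_fibration (subcomplexFinι ∂Δ[n]) (endpointsHom η d.1))))

theorem weakEquivalence_homotopyEndMap (hprod : ProductsPreserveFibrations C)
    (htower : TowersPreserveFibrations C) {F G : Kᵒᵖ × K ⥤ FibrantObject C} (η : F ⟶ G)
    (hη : ∀ x y : K, Fibration (η.app (op x, y)).hom)
    (hη' : ∀ x y : K, WeakEquivalence (η.app (op x, y)).hom) :
    WeakEquivalence (E.homotopyEndMap η) := by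
  rw [weakEquivalence_iff]
  have (n : ℕ) (d : ComposableArrows K n) : Fibration (endpointsHom η d).hom := hη _ _
  have h (n : ℕ) (d : ComposableArrows K n) : WeakEquivalence (endpointsHom η d).hom := hη' _ _
  refine (ReplacementProjections.totMap_mem (trivialFibrations C) _
    (RightModelCategory.isStableUnderTowers_trivialFibrations htower)
    E.sendsPushoutsToPullbacks.isGluedFromSimplices_boundary
    (E.replacementProjections_naturality η) (E.fibrations_cellsBoundary hprod F)
    (E.fibrations_cellsBoundary hprod G) (fun n => ?_)).2
  have hfib (d : NondegenerateChain K n) :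
      Fibration (pullbackPower E.mapping (subcomplexFinι ∂Δ[n]) (endpointsHom η d.1)) :=
    E.re3_fibration (subcomplexFinι ∂Δ[n]) (endpointsHom η d.1)
  exact ⟨(fibration_iff _).1 (hprod.fibration _ (fun d => E.isFibrant_pullback _ _) hfib),
    (weakEquivalence_iff _).1 (hprod.weakEquivalence _ (fun d => E.isFibrant_pullback _ _) hfib
      (fun d => E.re3_weakEquivalence (subcomplexFinι ∂Δ[n]) (endpointsHom η d.1)
        (Or.inr (h n d.1))))⟩

theorem isFibrant_homotopyEnd (hprod : ProductsPreserveFibrations C)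
    (htower : TowersPreserveFibrations C) (F : Kᵒᵖ × K ⥤ FibrantObject C) :
    IsFibrant (E.homotopyEnd F) := by
  have hT : IsFibrant (⊤_ C) := RightModelCategory.isFibrant_of_isTerminal terminalIsTerminal
  let G : Kᵒᵖ × K ⥤ FibrantObject C := (Functor.const _).obj ⟨⊤_ C, hT⟩
  let η : F ⟶ G := { app x := ObjectProperty.homMk (terminal.from _) }
  have hG : IsTerminal (E.homotopyEnd G) := isTerminalTot fun p q =>
    Classical.choice (E.re1_terminal (stdSimplexFin.obj p) ((E.cosimplicialReplacement G).obj q)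
      ⟨isTerminalPi fun _ => terminalIsTerminal⟩)
  -- Fibrancy of an object is by definition that its map to the terminal object is a fibration, so
  -- `η` is a pointwise fibration.
  have := E.fibration_homotopyEndMap hprod htower η (fun x y => (F.obj (op x, y)).property)
  exact (isFibrant_iff_of_isTerminal (E.homotopyEndMap η) hG).2 this

end RightEnrichment

/-! ### Simplicial closed model categories -/

section Lifting

variable {C : Type u} [Category.{v} C] [HasLimits C]

/-- A lift into the limit is built one stage at a time, each extension being a lifting problem
against the relative map; the transition maps can be arbitrary. -/
lemma isStableUnderTowers_rlp (W : MorphismProperty C) : IsStableUnderTowers W.rlp ⊤ := by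
  intro A B f hA hB _ _ hf S T i hi
  refine ⟨fun {a b} sq => ?_⟩
  have hsq (n : ℕ) : (a ≫ limit.π A (op n)) ≫ f.app (op n) = i ≫ b ≫ limit.π B (op n) := by
    have := congrArg (· ≫ limit.π B (op n)) sq.w
    simpa using this
  let L (n : ℕ) : Type v := { l : T ⟶ A.obj (op n) // i ≫ l = a ≫ limit.π A (op n) ∧
    l ≫ f.app (op n) = b ≫ limit.π B (op n) }
  have hstep (n : ℕ) (l : L n) :
      ∃ l' : L (n + 1), l'.1 ≫ A.map (homOfLE n.le_succ).op = l.1 := by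
    have := hf n i hi
    have hb : l.1 ≫ f.app (op n) =
        (b ≫ limit.π B (op (n + 1))) ≫ B.map (homOfLE n.le_succ).op := by
      rw [l.2.2, Category.assoc, limit.w]
    have sq' : CommSq (a ≫ limit.π A (op (n + 1))) i
        (pullback.lift (f := f.app (op n)) (g := B.map (homOfLE n.le_succ).op)
          (A.map (homOfLE n.le_succ).op) (f.app (op (n + 1))) (f.naturality _))
        (pullback.lift l.1 (b ≫ limit.π B (op (n + 1))) hb) := ⟨by
      apply pullback.hom_ext
      · rw [Category.assoc, Category.assoc, pullback.lift_fst, Category.assoc, limit.w,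
          pullback.lift_fst, l.2.1]
      · rw [Category.assoc, Category.assoc, pullback.lift_snd, Category.assoc, pullback.lift_snd,
          ← Category.assoc, hsq]⟩
    refine ⟨⟨sq'.lift, sq'.fac_left, ?_⟩, ?_⟩
    · have := congrArg (· ≫ pullback.snd _ _) sq'.fac_right
      simpa only [Category.assoc, pullback.lift_snd] using this
    · have := congrArg (· ≫ pullback.fst _ _) sq'.fac_right
      simpa only [Category.assoc, pullback.lift_fst] using this
  choose next hnext using hstep
  -- The recursion starts with the unique map to the terminal object at stage `0`.
  let l (n : ℕ) : L n := Nat.rec ⟨hA.from T, hA.hom_ext _ _, hB.hom_ext _ _⟩ next n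
  let c : Cone A :=
    { pt := T
      π := NatTrans.ofOpSequence (fun n => (l n).1)
        (fun n => (Category.id_comp _).trans (hnext n (l n)).symm) }
  have hc (n : ℕᵒᵖ) : limit.lift A c ≫ limit.π A n = (l n.unop).1 := limit.lift_π c n
  refine ⟨⟨⟨limit.lift A c, ?_, ?_⟩⟩⟩
  · refine limit.hom_ext fun n => ?_
    rw [Category.assoc, hc]
    exact (l n.unop).2.1
  · refine limit.hom_ext fun n => ?_
    rw [Category.assoc, limMap_π, ← Category.assoc, hc]
    exact (l n.unop).2.2

end Lifting

/-! ### Adjunctions for the mapping objects -/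

section Simplicial

variable {C : Type u} [Category.{v} C] [SimplicialCategory C]

/-- Maps from the monoidal unit turn the isomorphism of simplicial sets that defines a tensor into a
bijection on morphisms of `C`. -/
lemma tensor_bijective {L : SSet.{v}} {X T : C} {β : L ⟶ (X ⟶[SSet.{v}] T)} (hβ : IsTensor β)
    (Y : C) : Function.Bijective (fun f : T ⟶ Y => β ≫ eHomWhiskerLeft SSet.{v} X f) := by
  have := hβ Y
  let e : (T ⟶ Y) ≃ (L ⟶ (X ⟶[SSet.{v}] Y)) :=
    (eHomEquiv SSet.{v}).trans <|
      ((Iso.refl _).homCongr (asIso (tensorComparison β Y))).trans <|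
      ((ihom.adjunction L).homEquiv _ _).symm.trans ((ρ_ L).homCongr (Iso.refl _))
  convert e.bijective using 1
  funext f
  change _ = (ρ_ L).inv ≫ ((ihom.adjunction L).homEquiv _ _).symm
    (𝟙 _ ≫ eHomEquiv SSet.{v} f ≫ tensorComparison β Y) ≫ 𝟙 _
  rw [MonoidalClosed.homEquiv_symm_apply_eq, Category.id_comp, Category.comp_id,
    MonoidalClosed.uncurry_natural_left, tensorComparison, MonoidalClosed.uncurry_curry,
    eHomWhiskerLeft, whisker_exchange_assoc, rightUnitor_inv_naturality_assoc]

variable [ModelCategory C] [SimplicialModelCategory C]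

/-- Maps to `Map (L, Y)` are maps from `L` to the simplicial set of maps. -/
noncomputable def mappingEquiv (T : C) (L : FinSSet.{v}) (Y : C) :
    (T ⟶ ((mappingObject C).obj (op L)).obj Y) ≃ (L.obj ⟶ (T ⟶[SSet.{v}] Y)) :=
  (((Functor.essImage.liftFunctorCompIso (mappingPresheaf C) yoneda
    mappingPresheaf_mem_essImage).app (op L, Y)).app (op T)).toEquiv

lemma mappingEquiv_comp_left {T T' : C} (g : T' ⟶ T) (L : FinSSet.{v}) (Y : C)
    (u : T ⟶ ((mappingObject C).obj (op L)).obj Y) :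
    mappingEquiv T' L Y (g ≫ u) = mappingEquiv T L Y u ≫ eHomWhiskerRight SSet.{v} g Y :=
  NatTrans.naturality_apply ((Functor.essImage.liftFunctorCompIso (mappingPresheaf C) yoneda
    mappingPresheaf_mem_essImage).app (op L, Y)).hom g.op u

lemma mappingEquiv_comp_map {T : C} {L L' : FinSSet.{v}} (i : L' ⟶ L) {Y Y' : C} (f : Y ⟶ Y')
    (u : T ⟶ ((mappingObject C).obj (op L)).obj Y) :
    mappingEquiv T L' Y' (u ≫ (Functor.essImage.liftFunctor (mappingPresheaf C) yoneda
      mappingPresheaf_mem_essImage).map (X := (op L, Y)) (Y := (op L', Y')) (Prod.mkHom i.op f)) =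
      (i.hom ≫ mappingEquiv T L Y u) ≫ eHomWhiskerLeft SSet.{v} T f :=
  congrArg (fun φ => φ.app (op T) u) ((Functor.essImage.liftFunctorCompIso (mappingPresheaf C)
    yoneda mappingPresheaf_mem_essImage).hom.naturality
      (X := (op L, Y)) (Y := (op L', Y')) (Prod.mkHom i.op f))

lemma mappingEquiv_precomp {T : C} {L L' : FinSSet.{v}} (i : L' ⟶ L) {Y : C}
    (u : T ⟶ ((mappingObject C).obj (op L)).obj Y) :
    mappingEquiv T L' Y (u ≫ ((mappingObject C).map i.op).app Y) =
      i.hom ≫ mappingEquiv T L Y u := by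
  refine (mappingEquiv_comp_map i (𝟙 Y) u).trans ?_
  rw [eHomWhiskerLeft_id, Category.comp_id]

lemma mappingEquiv_postcomp {T : C} {L : FinSSet.{v}} {Y Y' : C} (f : Y ⟶ Y')
    (u : T ⟶ ((mappingObject C).obj (op L)).obj Y) :
    mappingEquiv T L Y' (u ≫ ((mappingObject C).obj (op L)).map f) =
      mappingEquiv T L Y u ≫ eHomWhiskerLeft SSet.{v} T f := by
  refine (mappingEquiv_comp_map (𝟙 L) f u).trans ?_
  exact congrArg (· ≫ _) (Category.id_comp _)

variable (C) in
-- By `mappingEquiv`, maps `T ⟶ Map (L, X)` are maps out of `L`, so colimits in `L` become limits.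
lemma sendsPushoutsToPullbacks_mappingObject : SendsPushoutsToPullbacks (mappingObject C) where
  initial L := by
    rintro ⟨hL⟩ X
    exact ⟨IsTerminal.ofUniqueHom (fun T => (mappingEquiv T L X).symm (hL.to _))
      (fun T _ => (mappingEquiv T L X).injective (hL.hom_ext _ _))⟩
  pushout {A L A' L' i f f' i'} sq _ X :=
    { w := by
        rw [← NatTrans.comp_app, ← NatTrans.comp_app, ← Functor.map_comp, ← Functor.map_comp,
          ← op_comp, ← op_comp, show i ≫ f' = f ≫ i' from ObjectProperty.hom_ext _ sq.w]
      isLimit' := by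
        have h (s : PullbackCone (((mappingObject C).map i.op).app X)
            (((mappingObject C).map f.op).app X)) :
            i.hom ≫ mappingEquiv _ _ _ s.fst = f.hom ≫ mappingEquiv _ _ _ s.snd := by
          rw [← mappingEquiv_precomp, ← mappingEquiv_precomp, s.condition]
        refine ⟨PullbackCone.IsLimit.mk _
          (fun s => (mappingEquiv _ _ _).symm (sq.desc _ _ (h s))) (fun s => ?_) (fun s => ?_)
          (fun s m h₁ h₂ => (mappingEquiv _ _ _).injective (sq.hom_ext ?_ ?_))⟩
        · apply (mappingEquiv _ _ _).injective
          rw [mappingEquiv_precomp, Equiv.apply_symm_apply, sq.inl_desc]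
        · apply (mappingEquiv _ _ _).injective
          rw [mappingEquiv_precomp, Equiv.apply_symm_apply, sq.inr_desc]
        · rw [Equiv.apply_symm_apply, sq.inl_desc, ← mappingEquiv_precomp, h₁]
        · rw [Equiv.apply_symm_apply, sq.inr_desc, ← mappingEquiv_precomp, h₂] }

/-- Maps to `Map (L, Y)` are maps out of a tensor. -/
lemma exists_tensorEquiv (T : C) (L : FinSSet.{v}) :
    ∃ (W : C) (e : ∀ Y : C, (T ⟶ ((mappingObject C).obj (op L)).obj Y) ≃ (W ⟶ Y)),
      ∀ ⦃Y Y' : C⦄ (f : Y ⟶ Y') (u : T ⟶ ((mappingObject C).obj (op L)).obj Y),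
        e Y' (u ≫ ((mappingObject C).obj (op L)).map f) = e Y u ≫ f := by
  have : L.obj.Finite := L.property
  obtain ⟨W, β, hβ⟩ := SimplicialModelCategory.sm0_tensor T L.obj
  refine ⟨W, fun Y => (mappingEquiv T L Y).trans
    (Equiv.ofBijective _ (tensor_bijective hβ Y)).symm, fun Y Y' f u => ?_⟩
  apply (Equiv.ofBijective _ (tensor_bijective hβ Y')).injective
  rw [Equiv.trans_apply, Equiv.apply_symm_apply, mappingEquiv_postcomp]
  change _ = β ≫ eHomWhiskerLeft SSet.{v} T _
  rw [eHomWhiskerLeft_comp, ← Category.assoc]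
  congr 1
  exact ((Equiv.ofBijective _ (tensor_bijective hβ Y)).apply_symm_apply _).symm

/-- `Map (L, -)` is right adjoint to tensoring with `L`, hence preserves products; the adjunction is
used one test object `T` at a time. -/
lemma isIso_mappingObject_pi [HasLimits C] (L : FinSSet.{v}) {I : Type v} (Y : I → C) :
    IsIso (Pi.lift fun i => ((mappingObject C).obj (op L)).map (Pi.π Y i)) := by
  refine isIso_of_yoneda_map_bijective _ fun T => ?_
  obtain ⟨W, e, he⟩ := exists_tensorEquiv T L
  refine ⟨fun u u' h => (e _).injective (Pi.hom_ext _ _ fun i => ?_), fun y =>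
    ⟨(e _).symm (Pi.lift fun i => e _ (y ≫ Pi.π _ i)), Pi.hom_ext _ _ fun i => ?_⟩⟩
  · have := congrArg (· ≫ Pi.π _ i) h
    simp only [Category.assoc, Pi.lift_π] at this
    rw [← he, ← he, this]
  · apply (e _).injective
    dsimp only
    rw [Category.assoc, Pi.lift_π, he, Equiv.apply_symm_apply, Pi.lift_π]

/-- `Map (L, -)` preserves terminal objects. -/
lemma isTerminal_mappingObject (L : FinSSet.{v}) {Y : C} (hY : IsTerminal Y) :
    Nonempty (IsTerminal (((mappingObject C).obj (op L)).obj Y)) := by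
  refine ⟨IsTerminal.ofUniqueHom
    (fun T => ((exists_tensorEquiv T L).choose_spec.choose Y).symm (hY.from _)) fun T _ =>
      ((exists_tensorEquiv T L).choose_spec.choose Y).injective (hY.hom_ext _ _)⟩

/-- Adjunction in two variables: transposing by `mappingEquiv` turns a lifting problem of `j`
against the corner map of `i` and `p` into one of `i` against `pullbackHom j p`. -/
lemma hasLiftingProperty_pullbackPower [HasLimits C] {A B X Y : C} (j : A ⟶ B) (p : X ⟶ Y)
    {L L' : FinSSet.{v}} (i : L ⟶ L') [HasLiftingProperty i.hom (pullbackHom j p)] :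
    HasLiftingProperty j (pullbackPower (mappingObject C) i p) where
  sq_hasLift {a b} sq := by
    have h₁ : a ≫ ((mappingObject C).map i.op).app X = j ≫ b ≫ pullback.fst _ _ := by
      simpa using congrArg (· ≫ pullback.fst _ _) sq.w
    have h₂ : a ≫ ((mappingObject C).obj (op L')).map p = j ≫ b ≫ pullback.snd _ _ := by
      simpa using congrArg (· ≫ pullback.snd _ _) sq.w
    have h₃ : (b ≫ pullback.fst _ _) ≫ ((mappingObject C).obj (op L)).map p =
        (b ≫ pullback.snd _ _) ≫ ((mappingObject C).map i.op).app Y := by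
      rw [Category.assoc, Category.assoc, pullback.condition]
    replace h₁ := congrArg (mappingEquiv _ _ _) h₁
    replace h₂ := congrArg (mappingEquiv _ _ _) h₂
    replace h₃ := congrArg (mappingEquiv _ _ _) h₃
    rw [mappingEquiv_precomp, mappingEquiv_comp_left] at h₁
    rw [mappingEquiv_postcomp, mappingEquiv_comp_left] at h₂
    rw [mappingEquiv_precomp, mappingEquiv_postcomp] at h₃
    have sq' : CommSq (mappingEquiv _ _ _ (b ≫ pullback.fst _ _)) i.hom (pullbackHom j p)
        (pullback.lift _ _ h₂) := ⟨by
      apply pullback.hom_ext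
      · rw [Category.assoc, Category.assoc, pullbackHom, pullback.lift_fst, pullback.lift_fst, h₁]
      · rw [Category.assoc, Category.assoc, pullbackHom, pullback.lift_snd, pullback.lift_snd, h₃]⟩
    have k₁ := congrArg (· ≫ pullback.fst _ _) sq'.fac_right
    have k₂ := congrArg (· ≫ pullback.snd _ _) sq'.fac_right
    simp only [pullbackHom, Category.assoc, pullback.lift_fst, pullback.lift_snd] at k₁ k₂
    -- Transposition permutes the three equations for a lift: restriction along `j` is the first
    -- component of the old lower triangle, and restriction along `i` is the old upper triangle.
    refine ⟨⟨⟨(mappingEquiv _ _ _).symm sq'.lift, ?_, pullback.hom_ext ?_ ?_⟩⟩⟩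
    · apply (mappingEquiv _ _ _).injective
      rw [mappingEquiv_comp_left, Equiv.apply_symm_apply]
      exact k₁
    · apply (mappingEquiv _ _ _).injective
      rw [Category.assoc, pullbackPower_fst, mappingEquiv_precomp, Equiv.apply_symm_apply]
      exact sq'.fac_left
    · apply (mappingEquiv _ _ _).injective
      rw [Category.assoc, pullbackPower_snd, mappingEquiv_postcomp, Equiv.apply_symm_apply]
      exact k₂

/-! ### Homotopy ends in a simplicial model category -/

section HomotopyEnd

variable {K : Type v} [SmallCategory K] [HasLimits C]

/-- The factors of the cosimplicial replacement. -/
noncomputable def mappingReplacementProjections (F : Kᵒᵖ × K ⥤ C) :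
    ReplacementProjections (mappingObject C) F (cosimplicialReplacement F) where
  proj {p} c := Pi.π (fun c : ComposableArrows K p.len => endpoints F c) c
  naturality _ _ := Pi.lift_π _ _
  isIso p _ := isIso_mappingObject_pi (stdSimplexFin.obj p) _

/-- Both fibrations and trivial fibrations are right lifting classes, so one argument serves for
both. Only liftings against the inclusions `∂Δ[n] ⟶ Δ[n]` matter, since these are the cells of the
tower. -/
lemma homotopyEndMap_mem_rlp (W : MorphismProperty C) {F G : Kᵒᵖ × K ⥤ C} (η : F ⟶ G)
    (h : ∀ ⦃A B : C⦄ (j : A ⟶ B), W j → ∀ x y : K,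
      SSet.modelCategoryQuillen.I.rlp (pullbackHom j (η.app (op x, y)))) :
    W.rlp (homotopyEndMap η) := by
  refine ReplacementProjections.totMap_mem (π := mappingReplacementProjections F)
    (π' := mappingReplacementProjections G) (η := η) W.rlp ⊤ (isStableUnderTowers_rlp W)
    (sendsPushoutsToPullbacks_mappingObject C).isGluedFromSimplices_boundary ?_
    (fun _ => trivial) (fun _ => trivial) (fun n => ?_)
  · intro p c
    exact Limits.Pi.map_π (fun c : ComposableArrows K p.len => endpointsHom η c) c
  -- A right lifting class is closed under products, so one nondegenerate chain can be treated at a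
  -- time.
  · refine MorphismProperty.limMap _ fun d A B j hj => ?_
    have : HasLiftingProperty (subcomplexFinι ∂Δ[n]).hom
        (pullbackHom j (endpointsHom η d.as.1)) :=
      h j hj _ _ _ (SSet.modelCategoryQuillen.boundary_ι_mem_I n)
    exact hasLiftingProperty_pullbackPower j (endpointsHom η d.as.1) (subcomplexFinι ∂Δ[n])

theorem fibration_homotopyEndMap {F G : Kᵒᵖ × K ⥤ C} (η : F ⟶ G)
    (hη : ∀ x y : K, Fibration (η.app (op x, y))) : Fibration (homotopyEndMap η) := by
  rw [fibration_iff, ← trivialCofibrations_rlp]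
  refine homotopyEndMap_mem_rlp _ η fun A B j hj x y => ?_
  obtain ⟨_, _⟩ := (mem_trivialCofibrations_iff j).1 hj
  have := hη x y
  -- The trivial half of (SM7) applies because `j` is a trivial cofibration; for weak equivalences
  -- it applies because `η` is trivial.
  exact SimplicialModelCategory.sm7_trivial j _ (Or.inl inferInstance)

theorem weakEquivalence_homotopyEndMap {F G : Kᵒᵖ × K ⥤ C} (η : F ⟶ G)
    (hη : ∀ x y : K, Fibration (η.app (op x, y)))
    (hη' : ∀ x y : K, WeakEquivalence (η.app (op x, y))) :
    WeakEquivalence (homotopyEndMap η) := by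
  have h : (cofibrations C).rlp (homotopyEndMap η) := by
    refine homotopyEndMap_mem_rlp _ η fun A B j hj x y => ?_
    have := (cofibration_iff j).2 hj
    have := hη x y
    exact SimplicialModelCategory.sm7_trivial j _ (Or.inr (hη' x y))
  rw [cofibrations_rlp, mem_trivialFibrations_iff] at h
  exact h.2

theorem isFibrant_homotopyEnd (F : Kᵒᵖ × K ⥤ C)
    (hF : ∀ x y : K, IsFibrant (F.obj (op x, y))) : IsFibrant (homotopyEnd F) := by
  let G : Kᵒᵖ × K ⥤ C := (Functor.const _).obj (⊤_ C)
  let η : F ⟶ G := { app x := terminal.from _ }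
  have hG : IsTerminal (homotopyEnd G) := isTerminalTot fun p q =>
    Classical.choice (isTerminal_mappingObject (stdSimplexFin.obj p)
      (isTerminalPi fun _ => terminalIsTerminal))
  exact (isFibrant_iff_of_isTerminal (homotopyEndMap η) hG).2 (fibration_homotopyEndMap η hF)

end HomotopyEnd

end Simplicial

theorem lemma1p8 :
    -- complete simplicial closed model categories
    (∀ (C : Type u) [Category.{v} C] [HasLimits C] [SimplicialCategory C] [ModelCategory C]
      [SimplicialModelCategory C] (K : Type v) [SmallCategory K],
      (∀ (F G : Kᵒᵖ × K ⥤ C) (η : F ⟶ G), (∀ x y : K, Fibration (η.app (op x, y))) →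
        Fibration (homotopyEndMap η) ∧
        ((∀ x y : K, WeakEquivalence (η.app (op x, y))) → WeakEquivalence (homotopyEndMap η))) ∧
      (∀ F : Kᵒᵖ × K ⥤ C, (∀ x y : K, IsFibrant (F.obj (op x, y))) →
        IsFibrant (homotopyEnd F))) ∧
    -- complete right model categories that are right enriched over finite simplicial sets
    (∀ (C : Type u) [Category.{v} C] [HasLimits C] [CategoryWithFibrations C]
      [CategoryWithWeakEquivalences C] [RightModelCategory C] (E : RightEnrichment.{w} C)
      (_ : ProductsPreserveFibrations C) (_ : TowersPreserveFibrations C)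
      (K : Type v) [SmallCategory K],
      (∀ (F G : Kᵒᵖ × K ⥤ FibrantObject C) (η : F ⟶ G),
        (∀ x y : K, Fibration (η.app (op x, y)).hom) →
        Fibration (E.homotopyEndMap η) ∧
        ((∀ x y : K, WeakEquivalence (η.app (op x, y)).hom) →
          WeakEquivalence (E.homotopyEndMap η))) ∧
      (∀ F : Kᵒᵖ × K ⥤ FibrantObject C, IsFibrant (E.homotopyEnd F))) := by
  refine ⟨?_, ?_⟩
  · intro C _ _ _ _ _ K _
    exact ⟨fun F G η hη => ⟨fibration_homotopyEndMap η hη, weakEquivalence_homotopyEndMap η hη⟩,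
      isFibrant_homotopyEnd⟩
  · intro C _ _ _ _ _ E hprod htower K _
    exact ⟨fun F G η hη => ⟨E.fibration_homotopyEndMap hprod htower η hη,
      E.weakEquivalence_homotopyEndMap hprod htower η hη⟩,
      E.isFibrant_homotopyEnd hprod htower⟩
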